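/- **Setting.** There are $K$ arms $a_1,\dots,a_K$ whose rewards $X(a_1),\dots,X(a_K)$ are mutually independent, integrable real random variables with known laws and means $\mu(a_i)=\mathbb E[X(a_i)]\neq 0$; each reward is realized once and is then fixed. In addition there is a safe arm $a_0$ with reward $0$. Put $A=\{a_1,\dots,a_K\}$, $A^+=A\cup\{a_0\}$, and, for $s\subseteq A$, $\mathrm{above}(s)=\{a\in s:\mu(a)>0\}$ and $\mathrm{below}(s)=\{a\in s:\mu(a)<0\}$. In each round $t=1,\dots,T$ an algorithm chooses, depending on the information $\mathcal I_t$ acquired so far (the realized actions and their observed rewards), a portfolio $p^t$, i.e. a probability distribution on $A^+$; an action is then drawn from $p^t$ and its reward is observed. The reward of the round is $r^t=\sum_{a\in A^+}p^t(a)\,\mathbb E[X(a)\mid\mathcal I_t]$, and the utility of the algorithm is $\mathcal U_T(\mathrm{ALG})=\mathbb E\big[\sum_{t=1}^T r^t\big]$. A portfolio is safe if $\sum_{a\in A}p^t(a)\,\mathbb E[X(a)\mid\mathcal I_t]\ge 0$, and $\mathrm{OPT}_T$ is the supremum of $\mathcal U_T$ over all algorithms that play safe portfolios in every round. **The algorithm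 SEGB.** Let $s$ be the set of unexplored arms. (1) As long as no positive reward has been realized and $\mathrm{above}(s)\ne\emptyset$: choose any $a_i\in\mathrm{above}(s)$; if $\mathrm{below}(s)=\emptyset$, play $a_i$; otherwise choose $a_j\in\mathrm{below}(s)$ of maximal mean and play $a_i$ with probability $\frac{-\mu(a_j)}{\mu(a_i)-\mu(a_j)}$ and $a_j$ with probability $\frac{\mu(a_i)}{\mu(a_i)-\mu(a_j)}$. (2) If no positive reward has been realized and $\mathrm{above}(s)=\emptyset$, play $a_0$ forever. (3) Once a positive reward is realized, explore the remaining arms of $\mathrm{above}(A)$ one by one; then let $a_{k^*}$ be an explored arm of highest observed reward $x$, and, as long as there are unexplored arms, choose an unexplored arm $a_j$ and play $a_{k^*}$ with probability $\frac{-\mu(a_j)}{x-\mu(a_j)}$ and $a_j$ with probability $\frac{x}{x-\mu(a_j)}$; when all arms are revealed, play the best arm forever. All choices left open (the arm $a_i$, ties, the order in which arms are explored in (3)) are arbitrary. **Quantities.** For a realization of the rewards let $\delta_1=\min\{X(a):a\in\mathrm{below}(A),X(a)>0\}$ and $\delta_2=\max\{X(a):a\in\mathrm{above}(A),X(a)>0\}$,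 and let the realized gap be $\max\{\delta_1,\delta_2\}$ (if only one of the two is defined, it is that one). Let $\delta>0$ be a constant such that almost surely, whenever $\delta_1$ or $\delta_2$ is defined, $\max\{\delta_1,\delta_2\}\ge\delta$. Let $\gamma=\max\{|\mu(a)|:\mu(a)<0\}$ ($\gamma=0$ if there is no such arm). **Proposition.** Assume that the rewards of the arms in $\mathrm{below}(A)$ are stochastically ordered: for any two of them, $X$ and $Y$, either $\Pr(X\ge c)\ge\Pr(Y\ge c)$ for all $c\in\mathbb R$, or $\Pr(Y\ge c)\ge\Pr(X\ge c)$ for all $c\in\mathbb R$. Then there is $T_0$ such that, for every implementation of SEGB and every $T>T_0$, $$\mathcal U_T(\mathrm{SEGB})\ \ge\ \Big(1-\frac{K(1+\gamma/\delta)}{T}\Big)\,\mathrm{OPT}_T .$$ -/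

import Mathlib

open MeasureTheory ProbabilityTheory

noncomputable section

namespace BayesSafe

/-- The arms `a_1, …, a_K` are the elements of `Fin K`.  An element of `Option (Fin K)` is an element of
`A⁺`: `some i` is the arm `i`, and `none` is the safe arm, whose reward is always `0`. -/
abbrev Action (K : ℕ) := Option (Fin K)

/-- What the decision maker has seen so far: the realized actions together with the rewards that they
revealed, most recent round first. -/
abbrev History (K : ℕ) := List (Action K × ℝ)

/-- The reward of an action when the (static) rewards of the arms are `x`. -/
def reward {K : ℕ} (x : Fin K → ℝ) : Action K → ℝ
  | none => 0
  | some i => x i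

/-- The history produced by the realized actions `acts` (most recent first) when the rewards are `x`. -/
def observe {K : ℕ} (x : Fin K → ℝ) (acts : List (Action K)) : History K :=
  acts.map fun a => (a, reward x a)

/-- An algorithm: it maps the acquired information to a portfolio, i.e. to a probability distribution on
`A⁺`, measurably in the observed rewards. -/
structure Algorithm (K : ℕ) where
  portfolio : History K → Action K → ℝ
  nonneg : ∀ h a, 0 ≤ portfolio h a
  sum_eq_one : ∀ h, ∑ a, portfolio h a = 1
  measurable : ∀ (acts : List (Action K)) (a : Action K),
    Measurable fun x : Fin K → ℝ => portfolio (observe x acts) a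

section Model

variable {K : ℕ} {Ω : Type*} [MeasurableSpace Ω]

/-- The prior mean `μ(a_i)`. -/
def mean (P : Measure Ω) (X : Fin K → Ω → ℝ) (i : Fin K) : ℝ := ∫ ω, X i ω ∂P

/-- The information in the rewards revealed by the realized actions `acts`: the σ-algebra generated by
the rewards of the arms that occur in `acts`. -/
abbrev info (X : Fin K → Ω → ℝ) (acts : List (Action K)) : MeasurableSpace Ω :=
  ⨆ i : Fin K, ⨆ _ : some i ∈ acts, MeasurableSpace.comap (X i) inferInstance

/-- The expected reward `E[X(a) | I]` of an action given the information revealed by `acts`. -/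
def condReward (P : Measure Ω) (X : Fin K → Ω → ℝ) (acts : List (Action K)) : Action K → Ω → ℝ
  | none => fun _ => 0
  | some i => P[X i | info X acts]

/-- The portfolio that the algorithm plays after the realized actions `acts` in the state of nature `ω`. -/
def played (alg : Algorithm K) (X : Fin K → Ω → ℝ) (acts : List (Action K)) (ω : Ω) : Action K → ℝ :=
  alg.portfolio (observe (fun i => X i ω) acts)

/-- The reward `r^t = ∑_a p^t(a) E[X(a) | I_t]` of the round that follows the realized actions `acts`. -/
def roundReward (P : Measure Ω) (X : Fin K → Ω → ℝ) (alg : Algorithm K)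
    (acts : List (Action K)) (ω : Ω) : ℝ :=
  ∑ a, played alg X acts ω a * condReward P X acts a ω

/-- The algorithm plays a Bayesian-safe portfolio after every history. -/
def IsSafe (P : Measure Ω) (X : Fin K → Ω → ℝ) (alg : Algorithm K) : Prop :=
  ∀ acts : List (Action K), ∀ᵐ ω ∂P, 0 ≤ roundReward P X alg acts ω

/-- The expectation over Nature's coin flips of the sum of the rewards of the next `n` rounds, given the
state of nature `ω` and the realized actions `acts` so far. -/
def totalReward (P : Measure Ω) (X : Fin K → Ω → ℝ) (alg : Algorithm K) :
    ℕ → List (Action K) → Ω → ℝ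
  | 0, _, _ => 0
  | n + 1, acts, ω => roundReward P X alg acts ω +
      ∑ a, played alg X acts ω a * totalReward P X alg n (a :: acts) ω

/-- The utility `U_T(ALG) = E[∑_{t ≤ T} r^t]`. -/
def utility (P : Measure Ω) (X : Fin K → Ω → ℝ) (alg : Algorithm K) (T : ℕ) : ℝ :=
  ∫ ω, totalReward P X alg T [] ω ∂P

/-- `OPT_T`: the highest utility of an algorithm that plays safe portfolios in every round. -/
def opt (P : Measure Ω) (X : Fin K → Ω → ℝ) (T : ℕ) : ℝ :=
  sSup {u | ∃ alg : Algorithm K, IsSafe P X alg ∧ u = utility P X alg T}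

/-- First-order stochastic dominance of `Y` over `Z`. -/
def Dominates (P : Measure Ω) (Y Z : Ω → ℝ) : Prop :=
  ∀ c : ℝ, P {ω | c ≤ Z ω} ≤ P {ω | c ≤ Y ω}

/-- The rewards of the arms with a negative mean are stochastically ordered. -/
def BelowOrdered (P : Measure Ω) (X : Fin K → Ω → ℝ) : Prop :=
  ∀ i j : Fin K, mean P X i < 0 → mean P X j < 0 →
    Dominates P (X i) (X j) ∨ Dominates P (X j) (X i)

end Model

section Segb

variable {K : ℕ}

/-- The arm `i` has been explored in the history `h`. -/
def Explored (h : History K) (i : Fin K) : Prop := ∃ v : ℝ, (some i, v) ∈ h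

/-- A positive reward has been realized. -/
def HasPositive (h : History K) : Prop := ∃ (i : Fin K) (v : ℝ), (some i, v) ∈ h ∧ 0 < v

/-- `i` belongs to `above(s)`, where `s` is the set of unexplored arms and `m` are the prior means. -/
def InAbove (m : Fin K → ℝ) (h : History K) (i : Fin K) : Prop := ¬ Explored h i ∧ 0 < m i

/-- `j` belongs to `below(s)`, where `s` is the set of unexplored arms and `m` are the prior means. -/
def InBelow (m : Fin K → ℝ) (h : History K) (j : Fin K) : Prop := ¬ Explored h j ∧ m j < 0

/-- The arm `k`, with observed reward `v`, is a best one among the explored arms. -/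
def IsBest (h : History K) (k : Fin K) (v : ℝ) : Prop :=
  (some k, v) ∈ h ∧ ∀ (i : Fin K) (w : ℝ), (some i, w) ∈ h → w ≤ v

/-- The portfolio that plays the action `a` with probability one. -/
def single (a : Action K) : Action K → ℝ := fun b => if b = a then 1 else 0

/-- The portfolio that mixes the arm `i`, of expected reward `u > 0`, and the arm `j`, of expected reward
`w < 0`, so that its expected reward is zero. -/
def mix (i j : Fin K) (u w : ℝ) : Action K → ℝ := fun b =>
  if b = some i then -w / (u - w) else if b = some j then u / (u - w) else 0

open Classical in
/-- The part of the history (a final segment of the list, i.e. the earliest rounds) up to the moment at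
which a positive reward has been realized and every arm of positive mean is explored, that is, up to
the moment at which the Bernoulli trials begin. -/
def beforeTrials (m : Fin K → ℝ) : History K → History K
  | [] => []
  | e :: h => if HasPositive h ∧ (∀ i, ¬ InAbove m h i) then beforeTrials m h else e :: h

/-- `SegbMove m h p`: after the history `h`, the portfolio `p` is one that `SEGB` may play.  The choices
that the algorithm leaves open (the arm of `above(s)`, ties, the order in which the remaining arms are
explored) are left open here. -/
inductive SegbMove (m : Fin K → ℝ) (h : History K) : (Action K → ℝ) → Prop
  /-- no positive reward yet, non-terminal state, `below(s)` non-empty: mix an arm of `above(s)` with an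
  arm of `below(s)` of highest mean -/
  | ogpMix (i j : Fin K) (hpos : ¬ HasPositive h) (hi : InAbove m h i) (hj : InBelow m h j)
      (hmax : ∀ j', InBelow m h j' → m j' ≤ m j) : SegbMove m h (mix i j (m i) (m j))
  /-- no positive reward yet, non-terminal state, `below(s)` empty -/
  | ogpSingle (i : Fin K) (hpos : ¬ HasPositive h) (hi : InAbove m h i)
      (hbelow : ∀ j, ¬ InBelow m h j) : SegbMove m h (single (some i))
  /-- terminal state without a positive reward: the safe arm, forever -/
  | safe (hpos : ¬ HasPositive h) (habove : ∀ i, ¬ InAbove m h i) : SegbMove m h (single none)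
  /-- a positive reward was realized: explore the remaining arms of `above(A)` -/
  | exploreAbove (i : Fin K) (hpos : HasPositive h) (hi : InAbove m h i) :
      SegbMove m h (single (some i))
  /-- Bernoulli trial mixing an unexplored arm with the arm `k*` that was best when the trials began -/
  | trial (k j : Fin K) (v : ℝ) (hpos : HasPositive h) (habove : ∀ i, ¬ InAbove m h i)
      (hk : IsBest (beforeTrials m h) k v) (hj : InBelow m h j) : SegbMove m h (mix k j v (m j))
  /-- all arms are revealed: play the best arm, forever -/
  | exploit (k : Fin K) (v : ℝ) (hpos : HasPositive h) (hall : ∀ i, Explored h i)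
      (hk : IsBest h k v) : SegbMove m h (single (some k))

/-- The algorithm is an implementation of `SEGB` for the prior means `m`. -/
def IsSegb (m : Fin K → ℝ) (alg : Algorithm K) : Prop :=
  ∀ (acts : List (Action K)) (x : Fin K → ℝ),
    SegbMove m (observe x acts) (alg.portfolio (observe x acts))

/-- The arms of `below(A)` with a positive realized reward. -/
def posBelow (m x : Fin K → ℝ) : Finset (Fin K) := {i | m i < 0 ∧ 0 < x i}

/-- The arms of `above(A)` with a positive realized reward. -/
def posAbove (m x : Fin K → ℝ) : Finset (Fin K) := {i | 0 < m i ∧ 0 < x i}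

open Classical in
/-- `δ₁`, the lowest positive reward in `below(A)`; `⊥` if undefined. -/
def gapBelow (m x : Fin K → ℝ) : WithBot ℝ :=
  if hne : (posBelow m x).Nonempty then (((posBelow m x).inf' hne x : ℝ) : WithBot ℝ) else ⊥

/-- `δ₂`, the highest positive reward in `above(A)`; `⊥` if undefined. -/
def gapAbove (m x : Fin K → ℝ) : WithBot ℝ := (posAbove m x).sup fun i => (x i : WithBot ℝ)

/-- The realized value of `max {δ₁, δ₂}`; `⊥` if neither is defined. -/
def realizedGap (m x : Fin K → ℝ) : WithBot ℝ := max (gapBelow m x) (gapAbove m x)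

open Classical in
/-- `γ`, the largest `|μ(a_i)|` over the arms of negative mean; `0` if there is no such arm. -/
def maxNegMean (m : Fin K → ℝ) : ℝ :=
  if hne : (Finset.univ.filter fun i => m i < 0).Nonempty then
    (Finset.univ.filter fun i => m i < 0).sup' hne fun i => |m i| else 0

end Segb

end BayesSafe

end

/-! Let q_i be the probability that the reward of arm i is not positive, and m(s) the expected
highest positive reward of the arms in s. The proof rests on a function C(s), the expected maximum
that is missed when s is unexplored and nothing positive has been found, together with a multiplier
l ≥ 0 of the safety constraint: q_a C(s∖a) − C(s) ≥ l μ(a) for every a in s, with equality for the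
arms of positive mean and for the arms of best negative mean (`exists_loss`). Averaged over a safe
portfolio, the expected loss cannot decrease; averaged over the zero-mean mixture of SEGB, it stays
constant.

C comes from a race. The mixing probabilities of SEGB are those with which each of two independent
exponential clocks of means μ(a_i) and |μ(a_j)| rings first. Exploration is thus a race of the total
clock of the positive-mean arms against the clocks of the negative-mean arms, run by decreasing
mean. Its value is a product of resolvents (1 − μ(a_i) G)⁻¹ of a killed generator G. They commute,
so the choice of a_i is immaterial. The stochastic order shows that the arm of best mean lowers m
the most per unit of |μ|; a maximum principle for the resolvents carries this comparison from m to
the value of the race.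

For safe algorithms `potential` is a supermartingale that bounds the reward of a round, so OPT_T ≤ T
(m(A) − C(A)) (`opt_le`). Under SEGB it is a martingale until a positive reward is found or no
positive-mean arm is left; in the latter case it is zero. It remains to count lost rounds: an arm
costs one round outside the trials, and on average (x − μ(a_j))/x ≤ 1 + γ/δ rounds in a trial, since
x ≥ δ almost surely (`ae_gapAtLeast`). This gives `le_utility_of_isSegb`. -/

namespace BayesSafe

/-! ### The exponential race: resolvents, maximum principle, and the loss function -/

section Race

variable {K : ℕ}

/-- The arm of highest mean in `B`, ties being broken by the index. -/
noncomputable def topArm (μ : Fin K → ℝ) (B : Finset (Fin K)) (h : B.Nonempty) : Fin K :=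
  (B.exists_max_image (fun i => toLex (μ i, i)) h).choose

theorem topArm_mem (μ : Fin K → ℝ) {B : Finset (Fin K)} (h : B.Nonempty) : topArm μ B h ∈ B :=
  (B.exists_max_image (fun i => toLex (μ i, i)) h).choose_spec.1

theorem toLex_le_topArm (μ : Fin K → ℝ) {B : Finset (Fin K)} (h : B.Nonempty) {j : Fin K}
    (hj : j ∈ B) : toLex (μ j, j) ≤ toLex (μ (topArm μ B h), topArm μ B h) :=
  (B.exists_max_image (fun i => toLex (μ i, i)) h).choose_spec.2 j hj

theorem le_topArm (μ : Fin K → ℝ) {B : Finset (Fin K)} (h : B.Nonempty) {j : Fin K}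
    (hj : j ∈ B) : μ j ≤ μ (topArm μ B h) := by
  have := toLex_le_topArm μ h hj
  rw [Prod.Lex.toLex_le_toLex] at this
  rcases this with h | h
  · exact h.le
  · exact h.1.le

/-- Breaking ties by the index makes the maximiser unique, so deleting another arm cannot move it.
The commutation `shift_deviation` depends on this. -/
theorem topArm_erase (μ : Fin K → ℝ) {B : Finset (Fin K)} (h : B.Nonempty) {j : Fin K}
    (hj : j ≠ topArm μ B h) (h' : (B.erase j).Nonempty) :
    topArm μ (B.erase j) h' = topArm μ B h := by
  have h1 := toLex_le_topArm μ h (Finset.mem_of_mem_erase (topArm_mem μ h'))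
  have h2 := toLex_le_topArm μ h' (Finset.mem_erase.2 ⟨hj.symm, topArm_mem μ h⟩)
  have := toLex_inj.1 (le_antisymm h1 h2)
  exact (Prod.mk.inj this).2

open Classical in
/-- The generator of the exploration of the arms of a set in the order of decreasing means: the arm `j`
takes an exponential time of mean `|μ j|`, and the exploration goes on with probability `q j`. -/
noncomputable def generator (μ q : Fin K → ℝ) :
    (Finset (Fin K) → ℝ) →ₗ[ℝ] (Finset (Fin K) → ℝ) where
  toFun f B := if h : B.Nonempty then
    (q (topArm μ B h) * f (B.erase (topArm μ B h)) - f B) / |μ (topArm μ B h)| else 0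
  map_add' f g := by
    funext B
    by_cases h : B.Nonempty
    · simp only [h, dif_pos, Pi.add_apply]; ring
    · simp [h]
  map_smul' c f := by
    funext B
    by_cases h : B.Nonempty
    · simp only [h, dif_pos, Pi.smul_apply, smul_eq_mul, RingHom.id_apply]; ring
    · simp [h]

theorem generator_apply (μ q : Fin K → ℝ) (f : Finset (Fin K) → ℝ) {B : Finset (Fin K)}
    (h : B.Nonempty) : generator μ q f B =
      (q (topArm μ B h) * f (B.erase (topArm μ B h)) - f B) / |μ (topArm μ B h)| := by
  simp [generator, h]

theorem generator_empty (μ q : Fin K → ℝ) (f : Finset (Fin K) → ℝ) : generator μ q f ∅ = 0 := by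
  simp [generator]

/-- The operator `1 - a G`, where `G` is the generator. -/
noncomputable def shift (μ q : Fin K → ℝ) (a : ℝ) :
    (Finset (Fin K) → ℝ) →ₗ[ℝ] (Finset (Fin K) → ℝ) :=
  LinearMap.id - a • generator μ q

theorem shift_apply (μ q : Fin K → ℝ) (a : ℝ) (f : Finset (Fin K) → ℝ) (B : Finset (Fin K)) :
    shift μ q a f B = f B - a * generator μ q f B := by
  simp [shift]

theorem shift_generator (μ q : Fin K → ℝ) (a : ℝ) (f : Finset (Fin K) → ℝ) :
    shift μ q a (generator μ q f) = generator μ q (shift μ q a f) := by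
  simp [shift]

theorem shift_comm (μ q : Fin K → ℝ) (a b : ℝ) (f : Finset (Fin K) → ℝ) :
    shift μ q a (shift μ q b f) = shift μ q b (shift μ q a f) := by
  simp only [shift, LinearMap.sub_apply, LinearMap.smul_apply, LinearMap.id_apply, map_sub, map_smul]
  module

/-- A maximum principle. With t the top arm of B, (1 + a/|μ t|) u(B) is the shifted value at B plus
(a/|μ t|) q_t u(B∖t), so the system is triangular along deletions and has nonnegative coefficients.
-/
theorem nonneg_of_shift_nonneg {μ q : Fin K → ℝ} (hq : ∀ i, 0 ≤ q i) {a : ℝ} (ha : 0 ≤ a)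
    {u : Finset (Fin K) → ℝ} {N : Finset (Fin K)} (h : ∀ B ⊆ N, 0 ≤ shift μ q a u B) :
    ∀ B ⊆ N, 0 ≤ u B := by
  intro B
  induction B using Finset.strongInduction with
  | H B ih =>
    intro hB
    have h1 := h B hB
    rw [shift_apply] at h1
    by_cases hne : B.Nonempty
    · rw [generator_apply μ q u hne] at h1
      set t := topArm μ B hne with ht
      have h2 := ih _ (Finset.erase_ssubset (topArm_mem μ hne)) ((Finset.erase_subset _ _).trans hB)
      rw [← ht] at h2
      set b := |μ t|
      have hb : 0 ≤ a / b := div_nonneg ha (abs_nonneg _)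
      have h3 : a * ((q t * u (B.erase t) - u B) / b) = a / b * (q t * u (B.erase t)) - a / b * u B := by
        ring
      rw [h3] at h1
      have h4 : 0 ≤ a / b * (q t * u (B.erase t)) := mul_nonneg hb (mul_nonneg (hq t) h2)
      by_contra hneg
      push Not at hneg
      have : a / b * u B ≤ 0 := mul_nonpos_of_nonneg_of_nonpos hb hneg.le
      have hq1 := hq t
      have h5 : u B - a / b * (q t * u (B.erase t)) + a / b * u B ≥ 0 := by linarith
      linarith
    · rw [Finset.not_nonempty_iff_eq_empty.1 hne, generator_empty] at h1
      rw [Finset.not_nonempty_iff_eq_empty.1 hne]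
      simpa using h1

theorem shift_injective {μ q : Fin K → ℝ} (hq : ∀ i, 0 ≤ q i) {a : ℝ} (ha : 0 ≤ a) :
    Function.Injective (shift μ q a) := by
  rw [← LinearMap.ker_eq_bot, LinearMap.ker_eq_bot']
  intro u hu
  funext B
  refine le_antisymm ?_ ?_
  · have := nonneg_of_shift_nonneg (μ := μ) hq ha (u := -u) (N := B) (by intro B _; simp [hu]) B subset_rfl
    simpa using this
  · exact nonneg_of_shift_nonneg (μ := μ) hq ha (u := u) (N := B) (by intro B _; simp [hu]) B subset_rfl

/-- On a finite-dimensional space an injective shift is invertible, and the inverses commute, so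
their product over a finite set is well defined. `D A B` stands for the expected value of m, with
killing, at the set that is left of B when independent exponential clocks of means |μ i|, i ∈ A,
have run one after another. -/
theorem exists_race {μ q : Fin K → ℝ} (hq : ∀ i, 0 ≤ q i) (m : Finset (Fin K) → ℝ) :
    ∃ D : Finset (Fin K) → Finset (Fin K) → ℝ, D ∅ = m ∧
      ∀ (A : Finset (Fin K)) (i : Fin K), i ∉ A → shift μ q |μ i| (D (insert i A)) = D A := by
  let e : Fin K → (Finset (Fin K) → ℝ) ≃ₗ[ℝ] (Finset (Fin K) → ℝ) := fun i =>
    LinearEquiv.ofInjectiveEndo (shift μ q |μ i|) (shift_injective hq (abs_nonneg _))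
  have he : ∀ i f, shift μ q |μ i| ((e i).symm f) = f := fun i f => (e i).apply_symm_apply f
  have : LeftCommutative fun (i : Fin K) f => (e i).symm f := by
    constructor
    intro i j f
    apply shift_injective hq (abs_nonneg (μ j))
    apply shift_injective hq (abs_nonneg (μ i))
    change shift μ q |μ i| (shift μ q |μ j| _) = shift μ q |μ i| (shift μ q |μ j| _)
    rw [he, he, shift_comm, he, he]
  refine ⟨fun A => Multiset.foldr (fun i f => (e i).symm f) m A.val, rfl, ?_⟩
  intro A i hi
  dsimp only
  rw [Finset.insert_val_of_notMem hi, Multiset.foldr_cons, he]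

variable {μ q : Fin K → ℝ} {m : Finset (Fin K) → ℝ} {D : Finset (Fin K) → Finset (Fin K) → ℝ}

/-- The generator commutes with the shifts, so −G(D A) solves the same recursion as D A, started
from −G m ≥ 0; the maximum principle applies. This is the sign of the multiplier. -/
theorem generator_race_nonpos (hq : ∀ i, 0 ≤ q i)
    (hstep : ∀ s : Finset (Fin K), ∀ a ∈ s, q a * m (s.erase a) ≤ m s) (h0 : D ∅ = m)
    (hD : ∀ (A : Finset (Fin K)) (i : Fin K), i ∉ A → shift μ q |μ i| (D (insert i A)) = D A)
    (A B : Finset (Fin K)) : generator μ q (D A) B ≤ 0 := by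
  induction A using Finset.induction_on generalizing B with
  | empty =>
    rw [h0]
    by_cases h : B.Nonempty
    · rw [generator_apply μ q _ h]
      exact div_nonpos_of_nonpos_of_nonneg (by linarith [hstep B _ (topArm_mem μ h)]) (abs_nonneg _)
    · rw [Finset.not_nonempty_iff_eq_empty.1 h, generator_empty]
  | insert i A hi ih =>
    have := nonneg_of_shift_nonneg (μ := μ) hq (abs_nonneg (μ i)) (u := -generator μ q (D (insert i A)))
      (N := B) (by
        intro B' _
        rw [map_neg, shift_generator, hD A i hi]
        simpa using ih B') B subset_rfl
    simpa using this

open Classical in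
/-- The difference between the effect of exploring the arm `j` and that of exploring the best arm. -/
noncomputable def deviation (μ q : Fin K → ℝ) (j : Fin K) (f : Finset (Fin K) → ℝ) :
    Finset (Fin K) → ℝ := fun B =>
  if j ∈ B then (q j * f (B.erase j) - f B) / |μ j| - generator μ q f B else 0

theorem deviation_topArm (f : Finset (Fin K) → ℝ) {B : Finset (Fin K)} (h : B.Nonempty) :
    deviation μ q (topArm μ B h) f B = 0 := by
  simp [deviation, topArm_mem, generator_apply μ q f h]

/-- Deleting j and deleting the top arm commute, and deleting j ≠ top leaves the top arm in place.
If j is the top arm, the deviation vanishes both at B and after the deletion. -/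
theorem shift_deviation (a : ℝ) (j : Fin K) (f : Finset (Fin K) → ℝ) :
    shift μ q a (deviation μ q j f) = deviation μ q j (shift μ q a f) := by
  funext B
  rw [shift_apply]
  by_cases hj : j ∈ B
  · have hB : B.Nonempty := ⟨j, hj⟩
    rw [generator_apply μ q _ hB]
    by_cases hjt : j = topArm μ B hB
    · have h1 : deviation μ q j f B = 0 := by
        conv_lhs => rw [hjt]
        exact deviation_topArm f hB
      have h2 : deviation μ q j (shift μ q a f) B = 0 := by
        conv_lhs => rw [hjt]
        exact deviation_topArm _ hB
      rw [h1, h2, ← hjt]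
      simp [deviation]
    · have ht : topArm μ B hB ∈ B.erase j := Finset.mem_erase.2 ⟨fun h => hjt h.symm, topArm_mem μ hB⟩
      have hj' : j ∈ B.erase (topArm μ B hB) := Finset.mem_erase.2 ⟨hjt, hj⟩
      have hBj : (B.erase j).Nonempty := ⟨_, ht⟩
      have htop := topArm_erase μ hB hjt hBj
      have h1 : deviation μ q j f B = (q j * f (B.erase j) - f B) / |μ j| - generator μ q f B := by
        simp [deviation, hj]
      have h2 : deviation μ q j (shift μ q a f) B =
          (q j * (f (B.erase j) - a * generator μ q f (B.erase j)) - (f B - a * generator μ q f B)) / |μ j|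
            - (generator μ q f B - a * generator μ q (generator μ q f) B) := by
        simp only [deviation, hj, if_true, shift_apply, ← shift_generator]
      have h3 : deviation μ q j f (B.erase (topArm μ B hB)) =
          (q j * f ((B.erase (topArm μ B hB)).erase j) - f (B.erase (topArm μ B hB))) / |μ j|
            - generator μ q f (B.erase (topArm μ B hB)) := by
        simp [deviation, hj']
      rw [h2, h1, h3, generator_apply μ q (generator μ q f) hB, generator_apply μ q f hBj, htop,
        generator_apply μ q f hB, Finset.erase_right_comm]
      ring
  · have h1 : deviation μ q j f B = 0 := by simp [deviation, hj]
    have h2 : deviation μ q j (shift μ q a f) B = 0 := by simp [deviation, hj]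
    rw [h1, h2]
    by_cases hB : B.Nonempty
    · rw [generator_apply μ q _ hB]
      simp [deviation, hj]
    · rw [Finset.not_nonempty_iff_eq_empty.1 hB, generator_empty]; simp

/-- By `shift_deviation` the deviation of D A obeys the resolvent recursion, so its sign is
inherited from m. The factor c lets one statement serve the inequality (c = 1) and its converse for
arms tied at the top (c = −1). -/
theorem deviation_race_nonneg (hq : ∀ i, 0 ≤ q i) {N : Finset (Fin K)} {j : Fin K} (c : ℝ)
    (hbase : ∀ B ⊆ N, 0 ≤ c * deviation μ q j m B) (h0 : D ∅ = m)
    (hD : ∀ (A : Finset (Fin K)) (i : Fin K), i ∉ A → shift μ q |μ i| (D (insert i A)) = D A)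
    (A : Finset (Fin K)) : ∀ B ⊆ N, 0 ≤ c * deviation μ q j (D A) B := by
  induction A using Finset.induction_on with
  | empty => rwa [h0]
  | insert i A hi ih =>
    refine nonneg_of_shift_nonneg (μ := μ) hq (abs_nonneg (μ i)) (u := c • deviation μ q j (D (insert i A))) ?_
    intro B hB
    rw [map_smul, shift_deviation, hD A i hi]
    exact ih B hB

/-- The top arm has the larger drop m(B) − q m(B∖·) and the smaller |μ|, hence the largest drop per
unit of |μ|. -/
theorem deviation_nonneg (hstep : ∀ s : Finset (Fin K), ∀ a ∈ s, q a * m (s.erase a) ≤ m s) (hμ : ∀ i, μ i ≠ 0)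
    (hdom : ∀ s : Finset (Fin K), ∀ a ∈ s, ∀ j ∈ s, μ a < 0 → μ j ≤ μ a → q a * m (s.erase a) ≤ q j * m (s.erase j))
    {B : Finset (Fin K)} (hB : ∀ i ∈ B, μ i < 0) (j : Fin K) : 0 ≤ deviation μ q j m B := by
  by_cases hj : j ∈ B
  · have hne : B.Nonempty := ⟨j, hj⟩
    simp only [deviation, hj, if_true, generator_apply μ q m hne]
    set t := topArm μ B hne with ht
    have htB : t ∈ B := topArm_mem μ hne
    have h1 := hdom B t htB j hj (hB t htB) (le_topArm μ hne hj)
    have h2 := hstep B j hj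
    have hle : |μ t| ≤ |μ j| := by
      rw [abs_of_neg (hB t htB), abs_of_neg (hB j hj)]
      linarith [le_topArm μ hne hj]
    have hpos : 0 < |μ t| := abs_pos.2 (hμ t)
    have h3 : (m B - q j * m (B.erase j)) / |μ j| ≤ (m B - q t * m (B.erase t)) / |μ t| :=
      div_le_div₀ (by linarith) (by linarith) hpos hle
    have e1 : (q j * m (B.erase j) - m B) / |μ j| = -((m B - q j * m (B.erase j)) / |μ j|) := by ring
    have e2 : (q t * m (B.erase t) - m B) / |μ t| = -((m B - q t * m (B.erase t)) / |μ t|) := by ring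
    rw [e1, e2]
    linarith
  · simp [deviation, hj]

/-- An arm of maximal mean may differ from `topArm` by a tie; the comparison `hdom` then applies in
the other direction, with equal denominators. -/
theorem deviation_nonpos
    (hdom : ∀ s : Finset (Fin K), ∀ a ∈ s, ∀ j ∈ s, μ a < 0 → μ j ≤ μ a → q a * m (s.erase a) ≤ q j * m (s.erase j))
    {B : Finset (Fin K)} (hB : ∀ i ∈ B, μ i < 0) {j : Fin K} (hmax : ∀ i ∈ B, μ i ≤ μ j) :
    deviation μ q j m B ≤ 0 := by
  by_cases hj : j ∈ B
  · have hne : B.Nonempty := ⟨j, hj⟩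
    simp only [deviation, hj, if_true, generator_apply μ q m hne]
    set t := topArm μ B hne with ht
    have htB : t ∈ B := topArm_mem μ hne
    have h1 := hdom B j hj t htB (hB j hj) (hmax t htB)
    rw [le_antisymm (hmax t htB) (le_topArm μ hne hj), sub_nonpos]
    exact div_le_div_of_nonneg_right (by linarith) (abs_nonneg _)
  · simp [deviation, hj]

/-- The expected loss of the order-based exploration, as a function of the set of unexplored arms. It
satisfies the optimality equation of the exploration under the safety constraint. -/
theorem exists_loss (hq : ∀ i, 0 ≤ q i) (hμ : ∀ i, μ i ≠ 0)
    (hstep : ∀ s : Finset (Fin K), ∀ a ∈ s, q a * m (s.erase a) ≤ m s)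
    (hdom : ∀ s : Finset (Fin K), ∀ a ∈ s, ∀ j ∈ s, μ a < 0 → μ j ≤ μ a →
      q a * m (s.erase a) ≤ q j * m (s.erase j)) :
    ∃ C : Finset (Fin K) → ℝ, (∀ s, (∀ i ∈ s, μ i < 0) → C s = m s) ∧ (∀ s, C s ≤ m s) ∧
      ∀ s, ∃ l : ℝ, 0 ≤ l ∧ (∀ a ∈ s, l * μ a ≤ q a * C (s.erase a) - C s) ∧
        (∀ a ∈ s, 0 < μ a → q a * C (s.erase a) - C s = l * μ a) ∧
        (∀ a ∈ s, μ a < 0 → (∀ b ∈ s, μ b < 0 → μ b ≤ μ a) → q a * C (s.erase a) - C s = l * μ a) ∧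
        ((∀ a ∈ s, 0 < μ a) → l = 0) := by
  obtain ⟨D, h0, hD⟩ := exists_race (μ := μ) hq m
  let A : Finset (Fin K) → Finset (Fin K) := fun s => s.filter fun i => 0 < μ i
  let B : Finset (Fin K) → Finset (Fin K) := fun s => s.filter fun i => μ i < 0
  let Q : Finset (Fin K) → ℝ := fun s => ∏ i ∈ A s, q i
  -- A loss occurs only if every positive-mean arm turns out not to be positive; these arms are all
  -- explored before the end, so their factors q come out of the race.
  let C : Finset (Fin K) → ℝ := fun s => Q s * D (A s) (B s)
  have hQ : ∀ s, 0 ≤ Q s := fun s => Finset.prod_nonneg fun i _ => hq i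
  have hBneg : ∀ s, ∀ i ∈ B s, μ i < 0 := fun s i hi => (Finset.mem_filter.1 hi).2
  let l : Finset (Fin K) → ℝ := fun s => -(Q s * generator μ q (D (A s)) (B s))
  have hl : ∀ s, 0 ≤ l s := fun s => by
    have := mul_nonpos_of_nonneg_of_nonpos (hQ s) (generator_race_nonpos hq hstep h0 hD (A s) (B s))
    simp only [l]; linarith
  have habove : ∀ s, ∀ a ∈ s, 0 < μ a → q a * C (s.erase a) - C s = l s * μ a := by
    intro s a ha hpos
    have haA : a ∈ A s := Finset.mem_filter.2 ⟨ha, hpos⟩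
    have e1 : A (s.erase a) = (A s).erase a := by simp only [A, Finset.filter_erase]
    have e2 : B (s.erase a) = B s := by
      simp only [B, Finset.filter_erase]
      apply Finset.erase_eq_of_notMem
      intro h
      exact lt_asymm hpos (Finset.mem_filter.1 h).2
    have e3 : q a * Q (s.erase a) = Q s := by
      simp only [Q, e1]; exact Finset.mul_prod_erase _ _ haA
    -- The resolvent equation for the clock of a: removing a changes D by −μ(a) G D, which is the
    -- equality with multiplier `l s`.
    have e4 := congrFun (hD ((A s).erase a) a (Finset.notMem_erase _ _)) (B s)
    rw [Finset.insert_erase haA, shift_apply, abs_of_pos hpos] at e4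
    simp only [C, l]
    rw [e1, e2, ← mul_assoc, e3, ← e4]
    ring
  have hbelow : ∀ s, ∀ a ∈ s, μ a < 0 → q a * C (s.erase a) - C s
      = l s * μ a + Q s * |μ a| * deviation μ q a (D (A s)) (B s) := by
    intro s a ha hneg
    have haB : a ∈ B s := Finset.mem_filter.2 ⟨ha, hneg⟩
    have e1 : A (s.erase a) = A s := by
      simp only [A, Finset.filter_erase]
      apply Finset.erase_eq_of_notMem
      intro h
      exact lt_asymm hneg (Finset.mem_filter.1 h).2
    have e2 : B (s.erase a) = (B s).erase a := by simp only [B, Finset.filter_erase]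
    have e3 : Q (s.erase a) = Q s := by simp only [Q, e1]
    simp only [C, l, deviation, haB, if_true]
    rw [e1, e2, e3, abs_of_neg hneg]
    have := hμ a
    field_simp
    ring
  have hadm : ∀ s, ∀ a ∈ s, l s * μ a ≤ q a * C (s.erase a) - C s := by
    intro s a ha
    rcases lt_or_gt_of_ne (hμ a) with h | h
    · rw [hbelow s a ha h]
      have := deviation_race_nonneg (N := B s) (j := a) hq 1 (by
        intro B' hB'
        rw [one_mul]
        exact deviation_nonneg hstep hμ hdom (fun i hi => hBneg s i (hB' hi)) a) h0 hD (A s) (B s)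
        subset_rfl
      rw [one_mul] at this
      have := mul_nonneg (mul_nonneg (hQ s) (abs_nonneg (μ a))) this
      linarith
    · exact (habove s a ha h).ge
  have hterm : ∀ s, (∀ i ∈ s, μ i < 0) → C s = m s := by
    intro s hs
    have e1 : A s = ∅ := Finset.filter_eq_empty_iff.2 fun {i} hi => (hs i hi).not_gt
    have e2 : B s = s := Finset.filter_eq_self.2 hs
    simp only [C, Q, e1, e2, h0, Finset.prod_empty, one_mul]
  refine ⟨C, hterm, ?_, fun s => ⟨l s, hl s, hadm s, habove s, ?_, ?_⟩⟩
  -- Exploring a positive-mean arm cannot decrease the expected loss, so C(s) ≤ q_a C(s∖a) ≤ q_a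
  -- m(s∖a) ≤ m(s).
  · intro s
    induction s using Finset.strongInduction with
    | H s ih =>
      by_cases hs : ∀ i ∈ s, μ i < 0
      · exact (hterm s hs).le
      · push Not at hs
        obtain ⟨a, ha, h⟩ := hs
        have hpos : 0 < μ a := lt_of_le_of_ne h (hμ a).symm
        have h1 := habove s a ha hpos
        have h2 := mul_nonneg (hl s) hpos.le
        have h3 := mul_le_mul_of_nonneg_left (ih _ (Finset.erase_ssubset ha)) (hq a)
        linarith [hstep s a ha]
  · intro a ha hneg hmax
    have := deviation_race_nonneg (N := B s) (j := a) hq (-1) (by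
        intro B' hB'
        have := deviation_nonpos (B := B') hdom (fun i hi => hBneg s i (hB' hi)) (j := a)
          (fun i hi => hmax i (Finset.mem_filter.1 (hB' hi)).1 (hBneg s i (hB' hi)))
        linarith) h0 hD (A s) (B s) subset_rfl
    have h2 := mul_nonneg (mul_nonneg (hQ s) (abs_nonneg (μ a))) this
    refine le_antisymm ?_ (hadm s a ha)
    rw [hbelow s a ha hneg]
    linarith
  · intro hs
    have e2 : B s = ∅ := Finset.filter_eq_empty_iff.2 fun {i} hi => (hs i hi).not_gt
    simp only [l, e2, generator_empty, mul_zero, neg_zero]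

end Race

/-! ### First-order stochastic dominance -/

section StochasticOrder

variable {Ω : Type*} [MeasurableSpace Ω] {P : Measure Ω} {Y Z M : Ω → ℝ}

theorem Dominates.max_const (h : Dominates P Y Z) (a : ℝ) :
    Dominates P (fun ω => max (Y ω) a) (fun ω => max (Z ω) a) := by
  intro c
  by_cases hc : c ≤ a
  · simp [hc]
  · simpa [hc] using h c

theorem Dominates.min_const (h : Dominates P Y Z) (a : ℝ) :
    Dominates P (fun ω => min (Y ω) a) (fun ω => min (Z ω) a) := by
  intro c
  by_cases hc : c ≤ a
  · simpa [hc] using h c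
  · simp [hc]

variable [IsProbabilityMeasure P]

theorem Dominates.measure_lt_le (hY : Measurable Y) (hZ : Measurable Z) (h : Dominates P Y Z)
    (c : ℝ) : P {ω | Y ω < c} ≤ P {ω | Z ω < c} := by
  have e : ∀ W : Ω → ℝ, {ω | W ω < c} = {ω | c ≤ W ω}ᶜ := fun W => by ext; simp
  rw [e, e, prob_compl_eq_one_sub (measurableSet_le measurable_const hY),
    prob_compl_eq_one_sub (measurableSet_le measurable_const hZ)]
  exact tsub_le_tsub_left (h c) 1

/-- Dominance speaks of closed half-lines; the open one {W > 0} is the increasing union of {W ≥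
1/(n+1)}. -/
theorem Dominates.measure_nonpos_le (hY : Measurable Y) (hZ : Measurable Z) (h : Dominates P Y Z) :
    P {ω | Y ω ≤ 0} ≤ P {ω | Z ω ≤ 0} := by
  have e : ∀ W : Ω → ℝ, {ω | W ω ≤ 0} = (⋃ n : ℕ, {ω | 1 / ((n : ℝ) + 1) ≤ W ω})ᶜ := fun W => by
    ext ω
    simp only [Set.mem_ofPred_eq, Set.mem_compl_iff, Set.mem_iUnion, not_exists, not_le]
    constructor
    · intro hω n
      exact hω.trans_lt (by positivity)
    · intro hω
      by_contra! hpos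
      obtain ⟨n, hn⟩ := exists_nat_one_div_lt hpos
      exact lt_asymm hn (hω n)
  have hmeas : ∀ W : Ω → ℝ, Measurable W → MeasurableSet (⋃ n : ℕ, {ω | 1 / ((n : ℝ) + 1) ≤ W ω}) :=
    fun W hW => MeasurableSet.iUnion fun n => measurableSet_le measurable_const hW
  have hmono : ∀ W : Ω → ℝ, Monotone fun n : ℕ => {ω | 1 / ((n : ℝ) + 1) ≤ W ω} := by
    intro W n k hnk ω hω
    simp only [Set.mem_ofPred_eq] at hω ⊢
    exact (Nat.one_div_le_one_div hnk).trans hω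
  rw [e, e, prob_compl_eq_one_sub (hmeas Y hY), prob_compl_eq_one_sub (hmeas Z hZ),
    (hmono Y).measure_iUnion, (hmono Z).measure_iUnion]
  exact tsub_le_tsub_left (iSup_mono fun n => h _) 1

/-- Layer-cake formula for the positive and the negative part separately: tails of the form {t ≤ W}
for the first, {W < −t} for the second. -/
theorem Dominates.integral_le (hY : Measurable Y) (hZ : Measurable Z) (hYi : Integrable Y P)
    (hZi : Integrable Z P) (h : Dominates P Y Z) : ∫ ω, Z ω ∂P ≤ ∫ ω, Y ω ∂P := by
  have pos : ∀ W : Ω → ℝ, Measurable W →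
      ∫⁻ ω, ENNReal.ofReal (W ω) ∂P = ∫⁻ t in Set.Ioi 0, P {ω | t ≤ W ω} := by
    intro W hW
    have e : ∀ ω, ENNReal.ofReal (W ω) = ENNReal.ofReal (max (W ω) 0) := fun ω => by
      simp [ENNReal.ofReal_max]
    simp_rw [e]
    rw [lintegral_eq_lintegral_meas_le (f := fun ω => max (W ω) 0) P (ae_of_all _ fun ω => le_max_right _ _)
      (hW.max measurable_const).aemeasurable]
    refine setLIntegral_congr_fun measurableSet_Ioi fun t ht => ?_
    congr 1
    ext ω
    simp [not_le.2 (show (0 : ℝ) < t from ht)]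
  have neg : ∀ W : Ω → ℝ, Measurable W →
      ∫⁻ ω, ENNReal.ofReal (-W ω) ∂P = ∫⁻ t in Set.Ioi 0, P {ω | W ω < -t} := by
    intro W hW
    have e : ∀ ω, ENNReal.ofReal (-W ω) = ENNReal.ofReal (max (-W ω) 0) := fun ω => by
      simp [ENNReal.ofReal_max]
    simp_rw [e]
    rw [lintegral_eq_lintegral_meas_lt (f := fun ω => max (-W ω) 0) P (ae_of_all _ fun ω => le_max_right _ _)
      (hW.neg.max measurable_const).aemeasurable]
    refine setLIntegral_congr_fun measurableSet_Ioi fun t ht => ?_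
    congr 1
    ext ω
    simp [not_lt.2 (show (0 : ℝ) < t from ht).le, lt_neg]
  have fin : ∀ W : Ω → ℝ, Integrable W P → ∫⁻ ω, ENNReal.ofReal (W ω) ∂P ≠ ⊤ :=
    fun W hW => hW.lintegral_lt_top.ne
  rw [integral_eq_lintegral_pos_part_sub_lintegral_neg_part hYi,
    integral_eq_lintegral_pos_part_sub_lintegral_neg_part hZi]
  have h1 : ∫⁻ ω, ENNReal.ofReal (Z ω) ∂P ≤ ∫⁻ ω, ENNReal.ofReal (Y ω) ∂P := by
    rw [pos Y hY, pos Z hZ]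
    exact lintegral_mono fun t => h t
  have h2 : ∫⁻ ω, ENNReal.ofReal (-Y ω) ∂P ≤ ∫⁻ ω, ENNReal.ofReal (-Z ω) ∂P := by
    rw [neg Y hY, neg Z hZ]
    exact lintegral_mono fun t => h.measure_lt_le hY hZ _
  have h3 := ENNReal.toReal_mono (fin Y hYi) h1
  have h4 := ENNReal.toReal_mono (fin (fun ω => -Z ω) hZi.neg) h2
  linarith

theorem Dominates.max_of_indepFun (hY : Measurable Y) (hZ : Measurable Z) (hM : Measurable M)
    (hYM : IndepFun Y M P) (hZM : IndepFun Z M P) (h : Dominates P Y Z) :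
    Dominates P (fun ω => max (Y ω) (M ω)) (fun ω => max (Z ω) (M ω)) := by
  intro c
  have e : ∀ W : Ω → ℝ, Measurable W → IndepFun W M P →
      P {ω | c ≤ max (W ω) (M ω)} = 1 - P {ω | W ω < c} * P {ω | M ω < c} := by
    intro W hW hWM
    have h1 : {ω | c ≤ max (W ω) (M ω)} = (W ⁻¹' Set.Iio c ∩ M ⁻¹' Set.Iio c)ᶜ := by
      ext ω
      simp [or_iff_not_imp_left]
    rw [h1, prob_compl_eq_one_sub ((hW measurableSet_Iio).inter (hM measurableSet_Iio)),
      hWM.measure_inter_preimage_eq_mul _ _ measurableSet_Iio measurableSet_Iio]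
    rfl
  rw [e Y hY hYM, e Z hZ hZM]
  exact tsub_le_tsub_left (mul_le_mul_left (h.measure_lt_le hY hZ c) _) 1

/-- Dominance without a larger mean forces equal tails. It turns the ordering assumption, which does
not say which arm dominates, into dominance by the arm of larger mean, ties included. -/
theorem Dominates.symm_of_integral_le (hY : Measurable Y) (hZ : Measurable Z) (hYi : Integrable Y P)
    (hZi : Integrable Z P) (h : Dominates P Y Z) (hle : ∫ ω, Y ω ∂P ≤ ∫ ω, Z ω ∂P) :
    Dominates P Z Y := by
  by_contra hcon
  simp only [Dominates, not_forall, not_le] at hcon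
  obtain ⟨c, hc⟩ := hcon
  -- A strict gap at the single level c persists on an interval [b, c], by continuity from above,
  -- and so contributes to the mean.
  obtain ⟨b, hbc, hb⟩ : ∃ b < c, P {ω | b ≤ Z ω} < P {ω | c ≤ Y ω} := by
    have e : {ω | c ≤ Z ω} = ⋂ n : ℕ, {ω | c - 1 / ((n : ℝ) + 1) ≤ Z ω} := by
      ext ω
      simp only [Set.mem_ofPred_eq, Set.mem_iInter]
      constructor
      · intro hω n
        have : (0 : ℝ) < 1 / ((n : ℝ) + 1) := by positivity
        linarith
      · intro hω
        by_contra! hlt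
        obtain ⟨n, hn⟩ := exists_nat_one_div_lt (sub_pos.2 hlt)
        linarith [hω n]
    have ht := tendsto_measure_iInter_atTop (μ := P) (s := fun n : ℕ => {ω | c - 1 / ((n : ℝ) + 1) ≤ Z ω})
      (fun n => (measurableSet_le measurable_const hZ).nullMeasurableSet)
      (by
        intro n k hnk ω hω
        have := Nat.one_div_le_one_div (α := ℝ) hnk
        simp only [Set.mem_ofPred_eq] at hω ⊢
        linarith) ⟨0, measure_ne_top _ _⟩
    rw [← e] at ht
    obtain ⟨n, hn⟩ := (ht.eventually_lt_const hc).exists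
    exact ⟨_, sub_lt_self c (by positivity), hn⟩
  have hmaxi : ∀ W : Ω → ℝ, Integrable W P → Integrable (fun ω => max (W ω) c) P :=
    fun W hW => hW.sup (integrable_const c)
  have hmini : ∀ W : Ω → ℝ, ∀ a, Integrable W P → Integrable (fun ω => min (W ω) a) P :=
    fun W a hW => hW.inf (integrable_const a)
  have hsi : ∀ W : Ω → ℝ, Integrable W P → Integrable (fun ω => min (max (W ω) b) c - b) P :=
    fun W hW => ((hW.sup (integrable_const b)).inf (integrable_const c)).sub (integrable_const b)
  -- Cut W at b and c: the outer layers compare by dominance, the middle layer strictly by the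
  -- choice of b.
  have hdec : ∀ W : Ω → ℝ, Integrable W P → ∫ ω, W ω ∂P
      = ∫ ω, min (W ω) b ∂P + ∫ ω, max (W ω) c ∂P - c + ∫ ω, (min (max (W ω) b) c - b) ∂P := by
    intro W hW
    have h1 : ∀ ω, W ω = (min (W ω) b + max (W ω) c - c) + (min (max (W ω) b) c - b) := by
      intro ω
      rcases le_total (W ω) b with h | h
      · rw [min_eq_left h, max_eq_right h, max_eq_right (h.trans hbc.le), min_eq_left hbc.le]; ring
      · rw [min_eq_right h, max_eq_left h]
        rcases le_total (W ω) c with h' | h'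
        · rw [max_eq_right h', min_eq_left h']; ring
        · rw [max_eq_left h', min_eq_right h']; ring
    have h0 : ∫ ω, c ∂P = c := by simp
    conv_lhs => rw [integral_congr_ae (ae_of_all _ h1)]
    have i1 := (hmini W b hW).add (hmaxi W hW)
    have i2 := i1.sub (integrable_const c)
    have := integral_add i2 (hsi W hW)
    simp only [Pi.add_apply, Pi.sub_apply] at this
    rw [this]
    have := integral_sub i1 (integrable_const c)
    simp only [Pi.add_apply] at this
    rw [this, h0]
    have := integral_add (hmini W b hW) (hmaxi W hW)
    rw [this]
  have hlow : (c - b) * P.real {ω | c ≤ Y ω} ≤ ∫ ω, (min (max (Y ω) b) c - b) ∂P := by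
    have hm : MeasurableSet {ω | c ≤ Y ω} := measurableSet_le measurable_const hY
    have : ∫ ω, {ω | c ≤ Y ω}.indicator (fun _ => c - b) ω ∂P = (c - b) * P.real {ω | c ≤ Y ω} := by
      rw [integral_indicator_const _ hm, smul_eq_mul, mul_comm]
    rw [← this]
    refine integral_mono ((integrable_const _).indicator hm) (hsi Y hYi) fun ω => ?_
    by_cases hω : c ≤ Y ω
    · simp [hω, hbc.le.trans hω]
    · simp [hω, hbc.le]
  have hup : ∫ ω, (min (max (Z ω) b) c - b) ∂P ≤ (c - b) * P.real {ω | b ≤ Z ω} := by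
    have hm : MeasurableSet {ω | b ≤ Z ω} := measurableSet_le measurable_const hZ
    have : ∫ ω, {ω | b ≤ Z ω}.indicator (fun _ => c - b) ω ∂P = (c - b) * P.real {ω | b ≤ Z ω} := by
      rw [integral_indicator_const _ hm, smul_eq_mul, mul_comm]
    rw [← this]
    refine integral_mono (hsi Z hZi) ((integrable_const _).indicator hm) fun ω => ?_
    by_cases hω : b ≤ Z ω
    · simp [hω]
    · simp [hω, (not_le.1 hω).le]
  have hlt : (c - b) * P.real {ω | b ≤ Z ω} < (c - b) * P.real {ω | c ≤ Y ω} :=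
    mul_lt_mul_of_pos_left ((ENNReal.toReal_lt_toReal (measure_ne_top _ _) (measure_ne_top _ _)).2 hb)
      (sub_pos.2 hbc)
  have h1 := (h.min_const b).integral_le (hY.min measurable_const) (hZ.min measurable_const)
    (hmini Y b hYi) (hmini Z b hZi)
  have h2 := (h.max_const c).integral_le (hY.max measurable_const) (hZ.max measurable_const)
    (hmaxi Y hYi) (hmaxi Z hZi)
  rw [hdec Y hYi, hdec Z hZi] at hle
  linarith

end StochasticOrder

/-! ### The highest positive reward of a set of arms -/

section MaxPos

variable {K : ℕ}

/-- The highest positive reward of the arms of `s`, `0` if there is none. -/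
noncomputable def maxPos (x : Fin K → ℝ) (s : Finset (Fin K)) : ℝ :=
  ((s.sup fun i => (x i).toNNReal : NNReal) : ℝ)

theorem maxPos_nonneg (x : Fin K → ℝ) (s : Finset (Fin K)) : 0 ≤ maxPos x s := NNReal.coe_nonneg _

theorem maxPos_empty (x : Fin K → ℝ) : maxPos x ∅ = 0 := by simp [maxPos]

theorem maxPos_insert (x : Fin K → ℝ) (i : Fin K) (s : Finset (Fin K)) :
    maxPos x (insert i s) = max (x i) (maxPos x s) := by
  have h := maxPos_nonneg x s
  simp only [maxPos, Finset.sup_insert, NNReal.coe_max, Real.coe_toNNReal'] at h ⊢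
  rw [max_assoc, max_eq_right h]

theorem le_maxPos {x : Fin K → ℝ} {s : Finset (Fin K)} {i : Fin K} (hi : i ∈ s) :
    x i ≤ maxPos x s := by
  rw [← Finset.insert_erase hi, maxPos_insert]
  exact le_max_left _ _

theorem maxPos_le {x : Fin K → ℝ} {s : Finset (Fin K)} {c : ℝ} (hc : 0 ≤ c) (h : ∀ i ∈ s, x i ≤ c) :
    maxPos x s ≤ c := by
  induction s using Finset.induction_on with
  | empty => rwa [maxPos_empty]
  | insert i s hi ih =>
    rw [maxPos_insert]
    exact max_le (h i (Finset.mem_insert_self _ _)) (ih fun j hj => h j (Finset.mem_insert_of_mem hj))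

theorem maxPos_eq_of_nonpos {x : Fin K → ℝ} {s t : Finset (Fin K)} (hst : s ⊆ t)
    (h : ∀ i ∈ t, i ∉ s → x i ≤ 0) : maxPos x t = maxPos x s := by
  refine le_antisymm (maxPos_le (maxPos_nonneg _ _) fun i hi => ?_)
    (maxPos_le (maxPos_nonneg _ _) fun i hi => le_maxPos (hst hi))
  by_cases his : i ∈ s
  · exact le_maxPos his
  · exact (h i hi his).trans (maxPos_nonneg _ _)

theorem measurable_maxPos {Ω : Type*} {mΩ : MeasurableSpace Ω} {X : Fin K → Ω → ℝ}
    {s : Finset (Fin K)} (h : ∀ i ∈ s, Measurable (X i)) :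
    Measurable fun ω => maxPos (fun i => X i ω) s := by
  induction s using Finset.induction_on with
  | empty => simp [maxPos_empty]
  | insert i s hi ih =>
    simp only [maxPos_insert]
    exact (h i (Finset.mem_insert_self _ _)).max (ih fun j hj => h j (Finset.mem_insert_of_mem hj))

theorem integrable_maxPos {Ω : Type*} [MeasurableSpace Ω] {P : Measure Ω} {X : Fin K → Ω → ℝ}
    (h : ∀ i, Integrable (X i) P) (s : Finset (Fin K)) :
    Integrable (fun ω => maxPos (fun i => X i ω) s) P := by
  induction s using Finset.induction_on with
  | empty => simp [maxPos_empty]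
  | insert i s hi ih =>
    simp only [maxPos_insert]
    exact (h i).sup ih

end MaxPos

/-! ### Independence and the expected highest positive reward -/

section Arms

variable {K : ℕ} {Ω : Type*} [MeasurableSpace Ω]

/-- The σ-algebra generated by the rewards of the arms in `S`. -/
abbrev armsInfo {Ω : Type*} (X : Fin K → Ω → ℝ) (S : Set (Fin K)) : MeasurableSpace Ω :=
  ⨆ i ∈ S, MeasurableSpace.comap (X i) inferInstance

theorem armsInfo_le {X : Fin K → Ω → ℝ} (hX : ∀ i, Measurable (X i)) (S : Set (Fin K)) :
    armsInfo X S ≤ ‹MeasurableSpace Ω› :=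
  iSup₂_le fun i _ => (hX i).comap_le

theorem measurable_armsInfo {Ω : Type*} (X : Fin K → Ω → ℝ) {S : Set (Fin K)} {i : Fin K} (hi : i ∈ S) :
    Measurable[armsInfo X S] (X i) :=
  Measurable.mono (comap_measurable (X i))
    (le_iSup₂ (f := fun (i : Fin K) (_ : i ∈ S) => MeasurableSpace.comap (X i) inferInstance) i hi) le_rfl

theorem indepFun_of_disjoint {P : Measure Ω} {X : Fin K → Ω → ℝ} (hX : ∀ i, Measurable (X i))
    (hind : iIndepFun X P) {S T : Set (Fin K)} (hST : Disjoint S T) {f g : Ω → ℝ}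
    (hf : Measurable[armsInfo X S] f) (hg : Measurable[armsInfo X T] g) : IndepFun f g P := by
  rw [IndepFun_iff_Indep]
  exact indep_of_indep_of_le_right (indep_of_indep_of_le_left
    (indep_iSup_of_disjoint (fun i => (hX i).comap_le) hind.iIndep hST) hf.comap_le) hg.comap_le

theorem integral_mul_of_disjoint {P : Measure Ω} {X : Fin K → Ω → ℝ} (hX : ∀ i, Measurable (X i))
    (hind : iIndepFun X P) {S T : Set (Fin K)} (hST : Disjoint S T) {f g : Ω → ℝ}
    (hf : Measurable[armsInfo X S] f) (hg : Measurable[armsInfo X T] g) :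
    ∫ ω, f ω * g ω ∂P = (∫ ω, f ω ∂P) * ∫ ω, g ω ∂P :=
  (indepFun_of_disjoint hX hind hST hf hg).integral_mul_eq_mul_integral
    (hf.mono (armsInfo_le hX S) le_rfl).aestronglyMeasurable
    (hg.mono (armsInfo_le hX T) le_rfl).aestronglyMeasurable

/-- The probability that the reward of the arm `i` is not positive. -/
def probNonpos (P : Measure Ω) (X : Fin K → Ω → ℝ) (i : Fin K) : ℝ := P.real {ω | X i ω ≤ 0}

/-- The expected highest positive reward of the arms of `s`. -/
noncomputable def meanMaxPos (P : Measure Ω) (X : Fin K → Ω → ℝ) (s : Finset (Fin K)) : ℝ :=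
  ∫ ω, maxPos (fun i => X i ω) s ∂P

variable {P : Measure Ω} [IsProbabilityMeasure P] {X : Fin K → Ω → ℝ}

open Classical in
/-- The expectation of the value of exploring the arm `a` from the set `s`, if the value after a reward that
is not positive is `c`. -/
theorem integral_explore (hX : ∀ i, Measurable (X i)) (hint : ∀ i, Integrable (X i) P)
    (hind : iIndepFun X P) (s : Finset (Fin K)) (a : Fin K) (c : ℝ) :
    ∫ ω, (if 0 < X a ω then maxPos (fun i => X i ω) s else c) ∂P
      = meanMaxPos P X s - probNonpos P X a * meanMaxPos P X (s.erase a) + probNonpos P X a * c := by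
  have hm : MeasurableSet {ω | X a ω ≤ 0} := measurableSet_le (hX a) measurable_const
  have e : ∀ ω, (if 0 < X a ω then maxPos (fun i => X i ω) s else c) = maxPos (fun i => X i ω) s
      - {ω | X a ω ≤ 0}.indicator 1 ω * maxPos (fun i => X i ω) (s.erase a)
      + {ω | X a ω ≤ 0}.indicator (fun _ => c) ω := by
    intro ω
    by_cases h : 0 < X a ω
    · simp [h, not_le.2 h]
    · have h' := not_lt.1 h
      rw [maxPos_eq_of_nonpos (Finset.erase_subset a s)]
      · simp [h, h']
      · intro i hi hi'
        have : i = a := by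
          by_contra hne
          exact hi' (Finset.mem_erase.2 ⟨hne, hi⟩)
        rwa [this]
  have hI : Integrable (fun ω => {ω | X a ω ≤ 0}.indicator (1 : Ω → ℝ) ω
      * maxPos (fun i => X i ω) (s.erase a)) P := by
    refine (integrable_maxPos hint _).bdd_mul (c := 1)
      ((measurable_one.indicator hm).aestronglyMeasurable) (ae_of_all _ fun ω => ?_)
    by_cases h : X a ω ≤ 0 <;> simp [h]
  have hprod : ∫ ω, {ω | X a ω ≤ 0}.indicator (1 : Ω → ℝ) ω * maxPos (fun i => X i ω) (s.erase a) ∂P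
      = probNonpos P X a * meanMaxPos P X (s.erase a) := by
    have hd : Disjoint ({a} : Set (Fin K)) (↑(s.erase a) : Set (Fin K)) := by
      rw [Set.disjoint_singleton_left]; simp
    rw [integral_mul_of_disjoint hX hind hd]
    · rw [integral_indicator_one hm]; rfl
    · have := measurable_armsInfo X (Set.mem_singleton a)
      have hset : MeasurableSet[armsInfo X {a}] {ω | X a ω ≤ 0} := this measurableSet_Iic
      exact (measurable_const (a := (1 : ℝ))).indicator hset
    · exact measurable_maxPos fun i hi => measurable_armsInfo X (Finset.mem_coe.2 hi)
  rw [integral_congr_ae (ae_of_all _ e)]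
  have i1 := (integrable_maxPos hint s).sub hI
  have h1 := integral_add i1 ((integrable_const (μ := P) c).indicator hm)
  have h2 := integral_sub (integrable_maxPos hint s) hI
  simp only [Pi.sub_apply] at h1
  rw [h1, h2, hprod, integral_indicator_const _ hm]
  rfl

theorem probNonpos_mul_le (hX : ∀ i, Measurable (X i)) (hint : ∀ i, Integrable (X i) P)
    (hind : iIndepFun X P) (s : Finset (Fin K)) (a : Fin K) :
    probNonpos P X a * meanMaxPos P X (s.erase a) ≤ meanMaxPos P X s := by
  have h := integral_explore hX hint hind s a 0
  have h0 : 0 ≤ ∫ ω, (if 0 < X a ω then maxPos (fun i => X i ω) s else 0) ∂P := by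
    refine integral_nonneg fun ω => ?_
    dsimp only
    split_ifs
    exacts [maxPos_nonneg _ _, le_rfl]
  linarith

theorem dominates_of_mean_le (hX : ∀ i, Measurable (X i)) (hint : ∀ i, Integrable (X i) P)
    (hord : BelowOrdered P X) {a j : Fin K} (ha : mean P X a < 0) (hle : mean P X j ≤ mean P X a) :
    Dominates P (X a) (X j) := by
  rcases hord a j ha (hle.trans_lt ha) with h | h
  · exact h
  · exact h.symm_of_integral_le (hX j) (hX a) (hint j) (hint a) hle

/-- Both factors compare: the dominating arm a is less often nonpositive, and removing a leaves j
together with R while removing j leaves the better arm a together with the same R, which is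
independent of both. -/
theorem probNonpos_mul_meanMaxPos_le (hX : ∀ i, Measurable (X i)) (hint : ∀ i, Integrable (X i) P)
    (hind : iIndepFun X P) (hord : BelowOrdered P X) (s : Finset (Fin K)) (a : Fin K) (ha : a ∈ s)
    (j : Fin K) (hj : j ∈ s) (hneg : mean P X a < 0) (hle : mean P X j ≤ mean P X a) :
    probNonpos P X a * meanMaxPos P X (s.erase a) ≤ probNonpos P X j * meanMaxPos P X (s.erase j) := by
  have hdom := dominates_of_mean_le hX hint hord hneg hle
  have hq : probNonpos P X a ≤ probNonpos P X j :=
    ENNReal.toReal_mono (measure_ne_top _ _) (hdom.measure_nonpos_le (hX a) (hX j))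
  rcases eq_or_ne a j with rfl | hne
  · exact le_rfl
  set R := (s.erase a).erase j with hR
  have e1 : s.erase a = insert j R := by
    rw [hR, Finset.insert_erase (Finset.mem_erase.2 ⟨hne.symm, hj⟩)]
  have e2 : s.erase j = insert a R := by
    rw [hR, Finset.erase_right_comm, Finset.insert_erase (Finset.mem_erase.2 ⟨hne, ha⟩)]
  have hind' : ∀ i, i ∉ R → IndepFun (X i) (fun ω => maxPos (fun i => X i ω) R) P := fun i hi =>
    indepFun_of_disjoint hX hind (S := {i}) (T := ↑R) (Set.disjoint_singleton_left.2 (by simpa using hi))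
      (measurable_armsInfo X (Set.mem_singleton i))
      (measurable_maxPos fun k hk => measurable_armsInfo X (Finset.mem_coe.2 hk))
  have hM : Measurable fun ω => maxPos (fun i => X i ω) R := measurable_maxPos fun i _ => hX i
  have h := (hdom.max_of_indepFun (hX a) (hX j) hM (hind' a (by simp [hR])) (hind' j (by simp [hR]))).integral_le
    ((hX a).max hM) ((hX j).max hM) ((hint a).sup (integrable_maxPos hint R))
    ((hint j).sup (integrable_maxPos hint R))
  have hmm : meanMaxPos P X (s.erase a) ≤ meanMaxPos P X (s.erase j) := by
    simp only [meanMaxPos, e1, e2, maxPos_insert]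
    exact h
  exact mul_le_mul hq hmm (integral_nonneg fun ω => maxPos_nonneg _ _) measureReal_nonneg

end Arms

/-! ### The potential and its expected change in one round -/

section Potential

variable {K : ℕ}

/-- The arms that do not occur in `acts`. -/
def unexplored (acts : List (Action K)) : Finset (Fin K) := {i | some i ∉ acts}

theorem mem_unexplored {acts : List (Action K)} {i : Fin K} : i ∈ unexplored acts ↔ some i ∉ acts := by
  simp [unexplored]

theorem unexplored_cons_none (acts : List (Action K)) : unexplored (none :: acts) = unexplored acts := by
  ext; simp [unexplored]

theorem unexplored_cons_some (acts : List (Action K)) (i : Fin K) :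
    unexplored (some i :: acts) = (unexplored acts).erase i := by
  ext; simp [unexplored, Finset.mem_erase]

theorem unexplored_cons_of_mem {acts : List (Action K)} {i : Fin K} (hi : some i ∈ acts) :
    unexplored (some i :: acts) = unexplored acts := by
  rw [unexplored_cons_some, Finset.erase_eq_of_notMem]
  simpa [mem_unexplored] using hi

theorem card_unexplored_cons {acts : List (Action K)} {i : Fin K} (hi : some i ∉ acts) :
    ((unexplored (some i :: acts)).card : ℝ) = (unexplored acts).card - 1 := by
  rw [unexplored_cons_some, ← Finset.card_erase_add_one (mem_unexplored.2 hi)]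
  push_cast; ring

theorem unexplored_nil : unexplored ([] : List (Action K)) = Finset.univ := by
  ext; simp [unexplored]

/-- Some arm of `acts` has a positive reward. -/
def Found (x : Fin K → ℝ) (acts : List (Action K)) : Prop := ∃ i, some i ∈ acts ∧ 0 < x i

theorem found_cons_none {x : Fin K → ℝ} {acts : List (Action K)} :
    Found x (none :: acts) ↔ Found x acts := by
  simp [Found]

theorem found_cons_some {x : Fin K → ℝ} {acts : List (Action K)} {i : Fin K} :
    Found x (some i :: acts) ↔ 0 < x i ∨ Found x acts := by
  simp [Found, or_and_right, exists_or]

theorem Found.cons {x : Fin K → ℝ} {acts : List (Action K)} (h : Found x acts) (a : Action K) :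
    Found x (a :: acts) :=
  h.imp fun _ hi => ⟨List.mem_cons_of_mem _ hi.1, hi.2⟩

variable {Ω : Type*} [MeasurableSpace Ω]

/-- `C` satisfies the optimality equation of the exploration under the safety constraint, `C s` being the
expected highest reward that is missed when the arms of `s` are unexplored and no positive reward has been
found. -/
structure IsLoss (P : Measure Ω) (X : Fin K → Ω → ℝ) (C : Finset (Fin K) → ℝ) : Prop where
  terminal : ∀ s, (∀ i ∈ s, mean P X i < 0) → C s = meanMaxPos P X s
  le_meanMaxPos : ∀ s, C s ≤ meanMaxPos P X s
  exists_price : ∀ s, ∃ l : ℝ, 0 ≤ l ∧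
    (∀ a ∈ s, l * mean P X a ≤ probNonpos P X a * C (s.erase a) - C s) ∧
    (∀ a ∈ s, 0 < mean P X a → probNonpos P X a * C (s.erase a) - C s = l * mean P X a) ∧
    (∀ a ∈ s, mean P X a < 0 → (∀ b ∈ s, mean P X b < 0 → mean P X b ≤ mean P X a) →
      probNonpos P X a * C (s.erase a) - C s = l * mean P X a) ∧
    ((∀ a ∈ s, 0 < mean P X a) → l = 0)

theorem exists_isLoss {P : Measure Ω} [IsProbabilityMeasure P] {X : Fin K → Ω → ℝ}
    (hX : ∀ i, Measurable (X i)) (hint : ∀ i, Integrable (X i) P) (hind : iIndepFun X P)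
    (hne : ∀ i, mean P X i ≠ 0) (hord : BelowOrdered P X) : ∃ C, IsLoss P X C := by
  obtain ⟨C, h1, h2, h3⟩ := exists_loss (μ := mean P X) (q := probNonpos P X) (m := meanMaxPos P X)
    (fun _ => measureReal_nonneg) hne (fun s a _ => probNonpos_mul_le hX hint hind s a)
    (probNonpos_mul_meanMaxPos_le hX hint hind hord)
  exact ⟨C, h1, h2, h3⟩

/-- The increase of the expected loss when an action is played and no positive reward has been found. -/
def lossChange (P : Measure Ω) (X : Fin K → Ω → ℝ) (C : Finset (Fin K) → ℝ) (s : Finset (Fin K)) :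
    Action K → ℝ
  | none => 0
  | some i => if i ∈ s then probNonpos P X i * C (s.erase i) - C s else 0

open Classical in
/-- An upper bound of the reward that can be reached per round: the highest positive reward if some positive
reward has been found, and the expectation of the highest positive reward that is not missed otherwise. -/
noncomputable def potential (P : Measure Ω) (X : Fin K → Ω → ℝ) (C : Finset (Fin K) → ℝ)
    (acts : List (Action K)) (ω : Ω) : ℝ :=
  if Found (fun i => X i ω) acts then maxPos (fun i => X i ω) Finset.univ
  else meanMaxPos P X (unexplored acts) - C (unexplored acts)

/-- A weight between `0` and `1` that is determined by the rewards revealed by `acts`. -/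
structure IsWeight (X : Fin K → Ω → ℝ) (acts : List (Action K)) (w : Ω → ℝ) : Prop where
  measurable : Measurable[info X acts] w
  nonneg : ∀ ω, 0 ≤ w ω
  le_one : ∀ ω, w ω ≤ 1

open Classical in
/-- The restriction of `w` to the states of nature in which `acts` has found no positive reward. -/
noncomputable def unfound (X : Fin K → Ω → ℝ) (acts : List (Action K)) (w : Ω → ℝ) (ω : Ω) : ℝ :=
  if Found (fun i => X i ω) acts then 0 else w ω

variable {P : Measure Ω} {X : Fin K → Ω → ℝ} {C : Finset (Fin K) → ℝ}
  {acts : List (Action K)} {w : Ω → ℝ}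

theorem info_le (hX : ∀ i, Measurable (X i)) (acts : List (Action K)) :
    info X acts ≤ ‹MeasurableSpace Ω› :=
  armsInfo_le hX {i | some i ∈ acts}

theorem info_mono_cons {Ω : Type*} (X : Fin K → Ω → ℝ) (a : Action K) (acts : List (Action K)) :
    info X acts ≤ info X (a :: acts) :=
  iSup₂_le fun i hi => le_iSup₂ (f := fun (i : Fin K) (_ : some i ∈ a :: acts) =>
    MeasurableSpace.comap (X i) inferInstance) i (List.mem_cons_of_mem _ hi)

theorem measurable_info {Ω : Type*} {X : Fin K → Ω → ℝ} {i : Fin K} (hi : some i ∈ acts) :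
    Measurable[info X acts] (X i) :=
  measurable_armsInfo X (S := {i | some i ∈ acts}) hi

theorem measurableSet_found {Ω : Type*} (X : Fin K → Ω → ℝ) (acts : List (Action K)) :
    MeasurableSet[info X acts] {ω | Found (fun i => X i ω) acts} := by
  have e : {ω | Found (fun i => X i ω) acts} = ⋃ i, ⋃ (_ : some i ∈ acts), X i ⁻¹' Set.Ioi 0 := by
    ext ω; simp [Found]
  rw [e]
  exact MeasurableSet.iUnion fun i => MeasurableSet.iUnion fun hi => measurable_info hi measurableSet_Ioi

theorem IsWeight.measurable' (hX : ∀ i, Measurable (X i)) (hw : IsWeight X acts w) : Measurable w :=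
  hw.measurable.mono (info_le hX acts) le_rfl

theorem IsWeight.norm_le {Ω : Type*} {X : Fin K → Ω → ℝ} {w : Ω → ℝ} (hw : IsWeight X acts w)
    (ω : Ω) : ‖w ω‖ ≤ 1 := by
  rw [Real.norm_of_nonneg (hw.nonneg ω)]; exact hw.le_one ω

theorem IsWeight.integrable_mul (hX : ∀ i, Measurable (X i)) (hw : IsWeight X acts w) {f : Ω → ℝ}
    (hf : Integrable f P) : Integrable (fun ω => w ω * f ω) P :=
  hf.bdd_mul (hw.measurable' hX).aestronglyMeasurable (ae_of_all _ hw.norm_le)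

theorem IsWeight.cons {Ω : Type*} {X : Fin K → Ω → ℝ} {w : Ω → ℝ} (hw : IsWeight X acts w)
    (a : Action K) : IsWeight X (a :: acts) w :=
  ⟨hw.measurable.mono (info_mono_cons X a acts) le_rfl, hw.nonneg, hw.le_one⟩

theorem IsWeight.unfound {Ω : Type*} {X : Fin K → Ω → ℝ} {w : Ω → ℝ} (hw : IsWeight X acts w) :
    IsWeight X acts (unfound X acts w) where
  measurable := Measurable.ite (measurableSet_found X acts) measurable_const hw.measurable
  nonneg ω := by unfold BayesSafe.unfound; split_ifs; exacts [le_rfl, hw.nonneg ω]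
  le_one ω := by unfold BayesSafe.unfound; split_ifs; exacts [zero_le_one, hw.le_one ω]

theorem IsWeight.mul {Ω : Type*} {X : Fin K → Ω → ℝ} {w v : Ω → ℝ} (hw : IsWeight X acts w) (hv : IsWeight X acts v) :
    IsWeight X acts fun ω => w ω * v ω :=
  ⟨hw.measurable.mul hv.measurable, fun ω => mul_nonneg (hw.nonneg ω) (hv.nonneg ω),
    fun ω => mul_le_one₀ (hw.le_one ω) (hv.nonneg ω) (hv.le_one ω)⟩

theorem observe_congr {x y : Fin K → ℝ} {acts : List (Action K)} (h : ∀ i, some i ∈ acts → x i = y i) :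
    observe x acts = observe y acts := by
  refine List.map_congr_left fun a ha => ?_
  cases a with
  | none => rfl
  | some i => simp [reward, h i ha]

theorem isWeight_played {Ω : Type*} (alg : Algorithm K) (X : Fin K → Ω → ℝ) (acts : List (Action K)) (a : Action K) :
    IsWeight X acts fun ω => played alg X acts ω a where
  measurable := by
    -- Unobserved rewards are replaced by 0: the portfolio does not see them, and the resulting
    -- vector is measurable in the acquired information.
    let Y : Fin K → Ω → ℝ := fun i ω => if some i ∈ acts then X i ω else 0
    have e : (fun ω => played alg X acts ω a)
        = (fun x => alg.portfolio (observe x acts) a) ∘ fun ω i => Y i ω := by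
      funext ω
      simp only [played, Function.comp]
      rw [observe_congr]
      intro i hi
      simp [Y, hi]
    rw [e]
    refine (alg.measurable acts a).comp (@measurable_pi_lambda _ _ _ (info X acts) _ _ fun i => ?_)
    by_cases hi : some i ∈ acts
    · simpa [Y, hi] using measurable_info hi
    · simp [Y, hi]
  nonneg ω := alg.nonneg _ _
  le_one ω := by
    rw [← alg.sum_eq_one (observe (fun i => X i ω) acts)]
    exact Finset.single_le_sum (fun b _ => alg.nonneg _ b) (Finset.mem_univ a)

theorem sum_played {Ω : Type*} (alg : Algorithm K) (X : Fin K → Ω → ℝ) (acts : List (Action K)) (ω : Ω) :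
    ∑ a, played alg X acts ω a = 1 :=
  alg.sum_eq_one _

theorem potential_nonneg (hC : IsLoss P X C) (acts : List (Action K)) (ω : Ω) :
    0 ≤ potential P X C acts ω := by
  unfold potential
  split_ifs
  · exact maxPos_nonneg _ _
  · linarith [hC.le_meanMaxPos (unexplored acts)]

theorem potential_cons_of_found (C : Finset (Fin K) → ℝ) {ω : Ω} (h : Found (fun i => X i ω) acts)
    (a : Action K) : potential P X C (a :: acts) ω = potential P X C acts ω := by
  simp [potential, h, h.cons a]

theorem integrable_potential [IsProbabilityMeasure P] (hX : ∀ i, Measurable (X i))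
    (hint : ∀ i, Integrable (X i) P) (C : Finset (Fin K) → ℝ) (acts : List (Action K)) :
    Integrable (potential P X C acts) P := by
  classical
  have e : potential P X C acts = {ω | Found (fun i => X i ω) acts}.piecewise
      (fun ω => maxPos (fun i => X i ω) Finset.univ)
      (fun _ => meanMaxPos P X (unexplored acts) - C (unexplored acts)) := by
    funext ω
    by_cases h : Found (fun i => X i ω) acts <;> simp [potential, h]
  rw [e]
  exact Integrable.piecewise (info_le hX acts _ (measurableSet_found X acts))
    (integrable_maxPos hint _).integrableOn (integrable_const _).integrableOn

/-- The weight depends on explored arms and the new potential on unexplored ones, so the integral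
factors; by `integral_explore` the m-terms at s∖a cancel and m(s) − q_a C(s∖a) remains. -/
theorem integral_unfound_mul_potential_cons [IsProbabilityMeasure P] (hX : ∀ i, Measurable (X i))
    (hint : ∀ i, Integrable (X i) P) (hind : iIndepFun X P) (hw : IsWeight X acts w) (a : Action K) :
    ∫ ω, unfound X acts w ω * potential P X C (a :: acts) ω ∂P
      = ∫ ω, unfound X acts w ω * potential P X C acts ω ∂P
        - lossChange P X C (unexplored acts) a * ∫ ω, unfound X acts w ω ∂P := by
  classical
  cases a with
  | none => simp [potential, found_cons_none, unexplored_cons_none, lossChange]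
  | some i =>
    by_cases hi : some i ∈ acts
    · have hi' : i ∉ unexplored acts := by simpa [mem_unexplored] using hi
      simp only [lossChange, hi', if_false, zero_mul, sub_zero]
      refine integral_congr_ae (ae_of_all _ fun ω => ?_)
      by_cases h : Found (fun i => X i ω) acts
      · simp [unfound, h]
      · have h' : ¬ Found (fun i => X i ω) (some i :: acts) := by
          rw [found_cons_some]
          exact fun h'' => h (h''.elim (fun h3 => ⟨i, hi, h3⟩) id)
        simp [potential, h, h', unexplored_cons_of_mem hi]
    · have hi' : i ∈ unexplored acts := mem_unexplored.2 hi
      set s := unexplored acts with hs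
      have e1 : ∀ ω, unfound X acts w ω * potential P X C (some i :: acts) ω = unfound X acts w ω *
          (if 0 < X i ω then maxPos (fun i => X i ω) s
            else meanMaxPos P X (s.erase i) - C (s.erase i)) := by
        intro ω
        by_cases h : Found (fun i => X i ω) acts
        · simp [unfound, h]
        · congr 1
          simp only [potential, found_cons_some, h, or_false, unexplored_cons_some, ← hs]
          split_ifs
          -- Nothing positive was found before, so the explored arms do not affect the overall
          -- maximum.
          · refine maxPos_eq_of_nonpos (Finset.subset_univ _) fun k _ hk => ?_
            rw [hs, mem_unexplored, not_not] at hk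
            by_contra hpos
            exact h ⟨k, hk, not_le.1 hpos⟩
          · rfl
      have e2 : ∀ ω, unfound X acts w ω * potential P X C acts ω
          = unfound X acts w ω * (meanMaxPos P X s - C s) := by
        intro ω
        by_cases h : Found (fun i => X i ω) acts
        · simp [unfound, h]
        · simp [potential, h, hs]
      have hd : Disjoint {i | some i ∈ acts} (↑s : Set (Fin K)) := by
        rw [Set.disjoint_left]
        intro k hk hk'
        exact mem_unexplored.1 (Finset.mem_coe.1 hk') hk
      have hmeas : Measurable[armsInfo X (↑s : Set (Fin K))] fun ω =>
          if 0 < X i ω then maxPos (fun i => X i ω) s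
            else meanMaxPos P X (s.erase i) - C (s.erase i) := by
        refine Measurable.ite ?_ (measurable_maxPos fun k hk => measurable_armsInfo X (Finset.mem_coe.2 hk))
          measurable_const
        exact measurable_armsInfo X (Finset.mem_coe.2 hi') measurableSet_Ioi
      rw [integral_congr_ae (ae_of_all _ e1), integral_congr_ae (ae_of_all _ e2),
        integral_mul_of_disjoint hX hind hd hw.unfound.measurable hmeas,
        integral_explore hX hint hind, integral_mul_const]
      simp only [lossChange, hi', if_true]
      ring

theorem integral_mul_potential_cons [IsProbabilityMeasure P] (hX : ∀ i, Measurable (X i))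
    (hint : ∀ i, Integrable (X i) P) (hind : iIndepFun X P) (hw : IsWeight X acts w) (a : Action K) :
    ∫ ω, w ω * potential P X C (a :: acts) ω ∂P = ∫ ω, w ω * potential P X C acts ω ∂P
      - lossChange P X C (unexplored acts) a * ∫ ω, unfound X acts w ω ∂P := by
  have hi := fun acts => integrable_potential hX hint C acts
  have h1 := integral_unfound_mul_potential_cons (C := C) hX hint hind hw a
  have e : ∫ ω, (w ω * potential P X C (a :: acts) ω - w ω * potential P X C acts ω) ∂P
      = ∫ ω, (unfound X acts w ω * potential P X C (a :: acts) ω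
          - unfound X acts w ω * potential P X C acts ω) ∂P := by
    refine integral_congr_ae (ae_of_all _ fun ω => ?_)
    by_cases h : Found (fun i => X i ω) acts
    · simp [unfound, h, potential_cons_of_found C h a]
    · simp [unfound, h]
  rw [integral_sub (hw.integrable_mul hX (hi _)) (hw.integrable_mul hX (hi _)),
    integral_sub (hw.unfound.integrable_mul hX (hi _)) (hw.unfound.integrable_mul hX (hi _))] at e
  linarith

theorem sum_integral_mul_potential_cons [IsProbabilityMeasure P] (hX : ∀ i, Measurable (X i))
    (hint : ∀ i, Integrable (X i) P) (hind : iIndepFun X P) (hw : IsWeight X acts w)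
    (alg : Algorithm K) :
    ∑ a, ∫ ω, w ω * played alg X acts ω a * potential P X C (a :: acts) ω ∂P
      = ∫ ω, w ω * potential P X C acts ω ∂P
        - ∫ ω, unfound X acts w ω *
          ∑ a, played alg X acts ω a * lossChange P X C (unexplored acts) a ∂P := by
  have hp := fun a => hw.mul (isWeight_played alg X acts a)
  have hpi := fun a => (hp a).integrable_mul hX (integrable_potential hX hint C acts)
  have hui := fun a => ((hp a).unfound.integrable_mul hX (integrable_const (μ := P) (1 : ℝ)))
  simp only [mul_one] at hui
  simp_rw [fun a => integral_mul_potential_cons (C := C) hX hint hind (hp a) a]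
  rw [Finset.sum_sub_distrib, ← integral_finsetSum _ fun a _ => hpi a]
  congr 1
  · refine integral_congr_ae (ae_of_all _ fun ω => ?_)
    dsimp only
    rw [← Finset.sum_mul, ← Finset.mul_sum, sum_played, mul_one]
  · simp_rw [← integral_const_mul]
    rw [← integral_finsetSum _ fun a _ => (hui a).const_mul _]
    refine integral_congr_ae (ae_of_all _ fun ω => ?_)
    dsimp only
    rw [Finset.mul_sum]
    refine Finset.sum_congr rfl fun a _ => ?_
    by_cases h : Found (fun i => X i ω) acts
    · simp [unfound, h]
    · simp only [unfound, h, if_false]; ring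

end Potential

/-! ### Upper bound for safe algorithms -/

section UpperBound

variable {K : ℕ} {Ω : Type*} [MeasurableSpace Ω] {P : Measure Ω} [IsProbabilityMeasure P]
  {X : Fin K → Ω → ℝ} {C : Finset (Fin K) → ℝ} {acts : List (Action K)} {w : Ω → ℝ}

theorem condReward_of_mem (hX : ∀ i, Measurable (X i)) (hint : ∀ i, Integrable (X i) P) {i : Fin K}
    (hi : some i ∈ acts) : condReward P X acts (some i) = X i :=
  condExp_of_stronglyMeasurable (info_le hX acts) (measurable_info hi).stronglyMeasurable (hint i)

theorem condReward_of_notMem (hX : ∀ i, Measurable (X i)) (hind : iIndepFun X P) {i : Fin K}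
    (hi : some i ∉ acts) : condReward P X acts (some i) =ᵐ[P] fun _ => mean P X i := by
  refine condExp_indep_eq (m₁ := armsInfo X {i}) (armsInfo_le hX _) (info_le hX acts)
    (measurable_armsInfo X (Set.mem_singleton i)).stronglyMeasurable ?_
  refine indep_iSup_of_disjoint (T := {i | some i ∈ acts}) (fun i => (hX i).comap_le) hind.iIndep ?_
  simpa using hi

theorem integrable_condReward {P : Measure Ω} (acts : List (Action K)) (a : Action K) :
    Integrable (condReward P X acts a) P := by
  cases a with
  | none => exact integrable_zero _ _ _
  | some i => exact integrable_condExp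

theorem integrable_roundReward {P : Measure Ω} (hX : ∀ i, Measurable (X i)) (alg : Algorithm K)
    (acts : List (Action K)) : Integrable (roundReward P X alg acts) P :=
  integrable_finsetSum _ fun a _ =>
    (isWeight_played alg X acts a).integrable_mul hX (integrable_condReward acts a)

theorem integrable_totalReward {P : Measure Ω} (hX : ∀ i, Measurable (X i)) (alg : Algorithm K) (n : ℕ)
    (acts : List (Action K)) : Integrable (totalReward P X alg n acts) P := by
  induction n generalizing acts with
  | zero => exact integrable_zero _ _ _
  | succ n ih =>
    exact (integrable_roundReward hX alg acts).add (integrable_finsetSum _ fun a _ =>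
      (isWeight_played alg X acts a).integrable_mul hX (ih _))

theorem integral_mul_totalReward_succ {P : Measure Ω} (hX : ∀ i, Measurable (X i)) (hw : IsWeight X acts w)
    (alg : Algorithm K) (n : ℕ) :
    ∫ ω, w ω * totalReward P X alg (n + 1) acts ω ∂P = ∫ ω, w ω * roundReward P X alg acts ω ∂P
      + ∑ a, ∫ ω, w ω * played alg X acts ω a * totalReward P X alg n (a :: acts) ω ∂P := by
  have hi := fun a => (hw.mul (isWeight_played alg X acts a)).integrable_mul hX
    (integrable_totalReward (P := P) hX alg n (a :: acts))
  rw [← integral_finsetSum _ fun a _ => hi a, ← integral_add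
    (hw.integrable_mul hX (integrable_roundReward hX alg acts)) (integrable_finsetSum _ fun a _ => hi a)]
  refine integral_congr_ae (ae_of_all _ fun ω => ?_)
  simp only [totalReward, mul_add, Finset.mul_sum, mul_assoc]

/-- The reward is compared with the potential after the action: if it is positive, the potential
becomes the overall maximum; otherwise the potential is still nonnegative. -/
theorem integral_mul_condReward_le (hX : ∀ i, Measurable (X i)) (hint : ∀ i, Integrable (X i) P)
    (hind : iIndepFun X P) (hC : IsLoss P X C) (hw : IsWeight X acts w) (a : Action K) :
    ∫ ω, w ω * condReward P X acts a ω ∂P ≤ ∫ ω, w ω * potential P X C (a :: acts) ω ∂P := by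
  have hpi := hw.integrable_mul hX (integrable_potential hX hint C (a :: acts))
  cases a with
  | none =>
    simp only [condReward, mul_zero, integral_zero]
    exact integral_nonneg fun ω => mul_nonneg (hw.nonneg ω) (potential_nonneg hC _ ω)
  | some i =>
    have e : ∫ ω, w ω * condReward P X acts (some i) ω ∂P = ∫ ω, w ω * X i ω ∂P := by
      by_cases hi : some i ∈ acts
      · rw [condReward_of_mem hX hint hi]
      · have hd : Disjoint {i | some i ∈ acts} ({i} : Set (Fin K)) := by simpa using hi
        rw [integral_mul_of_disjoint hX hind hd hw.measurable
          (measurable_armsInfo X (Set.mem_singleton i)), ← integral_mul_const]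
        refine integral_congr_ae ?_
        filter_upwards [condReward_of_notMem hX hind hi] with ω hω
        rw [hω]; rfl
    rw [e]
    refine integral_mono (hw.integrable_mul hX (hint i)) hpi fun ω =>
      mul_le_mul_of_nonneg_left ?_ (hw.nonneg ω)
    by_cases h : 0 < X i ω
    · have hf : Found (fun i => X i ω) (some i :: acts) := found_cons_some.2 (Or.inl h)
      simp only [potential, hf, if_true]
      exact le_maxPos (x := fun i => X i ω) (Finset.mem_univ i)
    · exact (not_lt.1 h).trans (potential_nonneg hC _ ω)

theorem integral_mul_roundReward_le (hX : ∀ i, Measurable (X i)) (hint : ∀ i, Integrable (X i) P)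
    (hind : iIndepFun X P) (hC : IsLoss P X C) (hw : IsWeight X acts w) (alg : Algorithm K) :
    ∫ ω, w ω * roundReward P X alg acts ω ∂P
      ≤ ∑ a, ∫ ω, w ω * played alg X acts ω a * potential P X C (a :: acts) ω ∂P := by
  have hp := fun a => hw.mul (isWeight_played alg X acts a)
  have e : ∫ ω, w ω * roundReward P X alg acts ω ∂P
      = ∑ a, ∫ ω, w ω * played alg X acts ω a * condReward P X acts a ω ∂P := by
    rw [← integral_finsetSum _ fun a _ => (hp a).integrable_mul hX (integrable_condReward acts a)]
    simp only [roundReward, Finset.mul_sum, mul_assoc]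
  rw [e]
  exact Finset.sum_le_sum fun a _ => integral_mul_condReward_le hX hint hind hC (hp a) a

/-- The expected reward of every action, given the information revealed by `acts`, is what it should be. -/
def IsTypical (P : Measure Ω) (X : Fin K → Ω → ℝ) (ω : Ω) : Prop :=
  ∀ (acts : List (Action K)) (i : Fin K), condReward P X acts (some i) ω =
    if some i ∈ acts then X i ω else mean P X i

theorem ae_isTypical (hX : ∀ i, Measurable (X i)) (hint : ∀ i, Integrable (X i) P)
    (hind : iIndepFun X P) : ∀ᵐ ω ∂P, IsTypical P X ω := by
  -- Lists over a finite type are countable, so one null set serves all histories.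
  refine ae_all_iff.2 fun acts => ae_all_iff.2 fun i => ?_
  by_cases hi : some i ∈ acts
  · simp [condReward_of_mem hX hint hi, hi]
  · filter_upwards [condReward_of_notMem hX hind hi] with ω hω
    simp [hω, hi]

/-- Weak duality: the average loss change is at least l times the reward of the round. Explored arms
fit because their rewards are at most 0 and their loss change is 0. -/
theorem sum_played_mul_lossChange_nonneg {P : Measure Ω} (hC : IsLoss P X C) {alg : Algorithm K} {ω : Ω}
    (hω : IsTypical P X ω) (hsafe : 0 ≤ roundReward P X alg acts ω)
    (hf : ¬ Found (fun i => X i ω) acts) :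
    0 ≤ ∑ a, played alg X acts ω a * lossChange P X C (unexplored acts) a := by
  obtain ⟨l, hl, hle, -⟩ := hC.exists_price (unexplored acts)
  refine (mul_nonneg hl hsafe).trans ?_
  rw [roundReward, Finset.mul_sum]
  refine Finset.sum_le_sum fun a _ => ?_
  rw [mul_left_comm]
  refine mul_le_mul_of_nonneg_left ?_ (alg.nonneg _ a)
  cases a with
  | none => simp [condReward, lossChange]
  | some i =>
    rw [hω]
    by_cases hi : some i ∈ acts
    · have hi' : i ∉ unexplored acts := by simpa [mem_unexplored] using hi
      simp only [hi, hi', if_true, if_false, lossChange]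
      exact mul_nonpos_of_nonneg_of_nonpos hl (not_lt.1 fun h => hf ⟨i, hi, h⟩)
    · have hi' : i ∈ unexplored acts := mem_unexplored.2 hi
      simpa only [hi, hi', if_true, if_false, lossChange] using hle i hi'

/-- The supermartingale argument. Arbitrary weights make the induction close: the probability of the
action just played is absorbed into the weight. -/
theorem integral_mul_totalReward_le (hX : ∀ i, Measurable (X i)) (hint : ∀ i, Integrable (X i) P)
    (hind : iIndepFun X P) (hC : IsLoss P X C) {alg : Algorithm K} (hsafe : IsSafe P X alg) (n : ℕ)
    (acts : List (Action K)) (w : Ω → ℝ) (hw : IsWeight X acts w) :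
    ∫ ω, w ω * totalReward P X alg n acts ω ∂P ≤ n * ∫ ω, w ω * potential P X C acts ω ∂P := by
  induction n generalizing acts w with
  | zero => simp [totalReward]
  | succ n ih =>
    have h1 := integral_mul_roundReward_le hX hint hind hC hw alg
    have h2 := sum_integral_mul_potential_cons (C := C) hX hint hind hw alg
    have h3 : 0 ≤ ∫ ω, unfound X acts w ω *
        ∑ a, played alg X acts ω a * lossChange P X C (unexplored acts) a ∂P := by
      refine integral_nonneg_of_ae ?_
      filter_upwards [ae_isTypical hX hint hind, hsafe acts] with ω hω hs
      by_cases hf : Found (fun i => X i ω) acts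
      · simp [unfound, hf]
      · exact mul_nonneg (hw.unfound.nonneg ω) (sum_played_mul_lossChange_nonneg hC hω hs hf)
    have h4 := Finset.sum_le_sum fun (a : Action K) (_ : a ∈ Finset.univ) =>
      ih (a :: acts) _ ((hw.mul (isWeight_played alg X acts a)).cons a)
    rw [← Finset.mul_sum] at h4
    have h5 := mul_le_mul_of_nonneg_left (h2.trans_le (sub_le_self _ h3)) (Nat.cast_nonneg (α := ℝ) n)
    rw [integral_mul_totalReward_succ hX hw alg n]
    push_cast
    linarith

/-- A safe algorithm earns at most the value of the order-based exploration per round. -/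
theorem utility_le (hX : ∀ i, Measurable (X i)) (hint : ∀ i, Integrable (X i) P)
    (hind : iIndepFun X P) (hC : IsLoss P X C) {alg : Algorithm K} (hsafe : IsSafe P X alg) (T : ℕ) :
    utility P X alg T ≤ T * (meanMaxPos P X Finset.univ - C Finset.univ) := by
  have h := integral_mul_totalReward_le hX hint hind hC hsafe T [] 1
    ⟨measurable_const (a := (1 : ℝ)), fun _ => zero_le_one, fun _ => le_rfl⟩
  have hf : ∀ ω, ¬ Found (fun i => X i ω) ([] : List (Action K)) := fun ω => by simp [Found]
  simpa [potential, hf, unexplored_nil, utility] using h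

theorem opt_le (hX : ∀ i, Measurable (X i)) (hint : ∀ i, Integrable (X i) P)
    (hind : iIndepFun X P) (hC : IsLoss P X C) (T : ℕ) :
    opt P X T ≤ T * (meanMaxPos P X Finset.univ - C Finset.univ) := by
  refine Real.sSup_le ?_ (mul_nonneg (Nat.cast_nonneg _) (sub_nonneg.2 (hC.le_meanMaxPos _)))
  rintro u ⟨alg, hsafe, rfl⟩
  exact utility_le hX hint hind hC hsafe T

end UpperBound

/-! ### SEGB along a fixed state of nature -/

section LowerBound

variable {K : ℕ} {m x : Fin K → ℝ} {acts : List (Action K)}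

theorem mem_observe {i : Fin K} {v : ℝ} : (some i, v) ∈ observe x acts ↔ some i ∈ acts ∧ v = x i := by
  simp only [observe, List.mem_map, Prod.mk.injEq]
  constructor
  · rintro ⟨a, ha, rfl, rfl⟩
    exact ⟨ha, rfl⟩
  · rintro ⟨hi, rfl⟩
    exact ⟨_, hi, rfl, rfl⟩

theorem explored_observe {i : Fin K} : Explored (observe x acts) i ↔ some i ∈ acts := by
  simp [Explored, mem_observe]

theorem hasPositive_observe : HasPositive (observe x acts) ↔ Found x acts := by
  simp only [HasPositive, mem_observe, Found]
  constructor
  · rintro ⟨i, v, ⟨hi, rfl⟩, h⟩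
    exact ⟨i, hi, h⟩
  · rintro ⟨i, hi, h⟩
    exact ⟨i, _, ⟨hi, rfl⟩, h⟩

theorem inAbove_observe {i : Fin K} :
    InAbove m (observe x acts) i ↔ i ∈ unexplored acts ∧ 0 < m i := by
  simp [InAbove, explored_observe, mem_unexplored]

theorem inBelow_observe {i : Fin K} :
    InBelow m (observe x acts) i ↔ i ∈ unexplored acts ∧ m i < 0 := by
  simp [InBelow, explored_observe, mem_unexplored]

theorem beforeTrials_spec {h : History K} (hpos : HasPositive h) (habove : ∀ i, ¬ InAbove m h i) :
    HasPositive (beforeTrials m h) ∧ (∀ i, ¬ InAbove m (beforeTrials m h) i) ∧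
      beforeTrials m h ⊆ h := by
  induction h with
  | nil => exact ⟨hpos, habove, fun _ h => h⟩
  | cons e h ih =>
    rw [beforeTrials]
    split_ifs with hc
    · obtain ⟨h1, h2, h3⟩ := ih hc.1 hc.2
      exact ⟨h1, h2, fun _ hx => List.mem_cons_of_mem _ (h3 hx)⟩
    · exact ⟨hpos, habove, fun _ h => h⟩

theorem sum_single_mul (a : Action K) (f : Action K → ℝ) : ∑ b, single a b * f b = f a := by
  simp [single]

theorem sum_mix_mul {i j : Fin K} (hij : i ≠ j) (u w : ℝ) (f : Action K → ℝ) :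
    ∑ b, mix i j u w b * f b = -w / (u - w) * f (some i) + u / (u - w) * f (some j) := by
  have hij' : some j ≠ some i := fun h => hij (Option.some.inj h).symm
  have e : ∀ b, mix i j u w b * f b = (if b = some i then -w / (u - w) * f (some i) else 0)
      + (if b = some j then u / (u - w) * f (some j) else 0) := by
    intro b
    by_cases h1 : b = some i
    · subst h1
      simp [mix, hij]
    · by_cases h2 : b = some j
      · subst h2
        simp [mix, hij']
      · simp [mix, h1, h2]
  simp only [e, Finset.sum_add_distrib, Finset.sum_ite_eq', Finset.mem_univ, if_true]

theorem sum_mix_mul_eq_zero {i j : Fin K} (hij : i ≠ j) {u w l : ℝ} {f : Action K → ℝ}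
    (hi : f (some i) = l * u) (hj : f (some j) = l * w) : ∑ b, mix i j u w b * f b = 0 := by
  rw [sum_mix_mul hij, hi, hj]
  ring

/-- Every positive reward that is the best one of a set which contains the arms of positive mean is at least
`δ`. -/
def GapAtLeast (m x : Fin K → ℝ) (δ : ℝ) : Prop :=
  ∀ v, (∃ i, 0 < x i ∧ x i ≤ v) → (∀ i, 0 < m i → x i ≤ v) → δ ≤ v

/-- What is seen in a Bernoulli trial. -/
theorem trial_spec {δ : ℝ} (hgap : GapAtLeast m x δ) {k : Fin K} {v : ℝ}
    (hpos : HasPositive (observe x acts)) (habove : ∀ i, ¬ InAbove m (observe x acts) i)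
    (hk : IsBest (beforeTrials m (observe x acts)) k v) : some k ∈ acts ∧ v = x k ∧ δ ≤ v := by
  obtain ⟨h1, h2, h3⟩ := beforeTrials_spec hpos habove
  obtain ⟨hk1, hk2⟩ := mem_observe.1 (h3 hk.1)
  refine ⟨hk1, hk2, hgap v ?_ ?_⟩
  · obtain ⟨i, w, hw, hw0⟩ := h1
    have := (mem_observe.1 (h3 hw)).2
    exact ⟨i, this ▸ hw0, this ▸ hk.2 i w hw⟩
  · intro i hi
    have : Explored (beforeTrials m (observe x acts)) i := by
      by_contra hne
      exact h2 i ⟨hne, hi⟩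
    obtain ⟨w, hw⟩ := this
    rw [← (mem_observe.1 (h3 hw)).2]
    exact hk.2 i w hw

variable {Ω : Type*} [MeasurableSpace Ω] {P : Measure Ω}
  {X : Fin K → Ω → ℝ} {C : Finset (Fin K) → ℝ} {alg : Algorithm K} {ω : Ω}

theorem IsTypical.of_mem (hω : IsTypical P X ω) {i : Fin K} (hi : some i ∈ acts) :
    condReward P X acts (some i) ω = X i ω := by
  rw [hω, if_pos hi]

theorem IsTypical.of_notMem (hω : IsTypical P X ω) {i : Fin K} (hi : i ∈ unexplored acts) :
    condReward P X acts (some i) ω = mean P X i := by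
  rw [hω, if_neg (mem_unexplored.1 hi)]

theorem roundReward_nonneg_of_isSegb (halg : IsSegb (mean P X) alg) {δ : ℝ}
    (hω : IsTypical P X ω) (hgap : GapAtLeast (mean P X) (fun i => X i ω) δ) (acts : List (Action K)) :
    0 ≤ roundReward P X alg acts ω := by
  unfold roundReward played
  have key := halg acts fun i => X i ω
  generalize alg.portfolio (observe (fun i => X i ω) acts) = p at key
  cases key with
  | ogpMix i j hpos hi hj hmax =>
    rw [inAbove_observe] at hi
    rw [inBelow_observe] at hj
    have hij : i ≠ j := by rintro rfl; exact lt_asymm hi.2 hj.2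
    rw [sum_mix_mul_eq_zero hij (l := 1)]
    · rw [hω.of_notMem hi.1, one_mul]
    · rw [hω.of_notMem hj.1, one_mul]
  | ogpSingle i hpos hi hbelow =>
    rw [inAbove_observe] at hi
    rw [sum_single_mul, hω.of_notMem hi.1]
    exact hi.2.le
  | safe hpos habove => rw [sum_single_mul]; rfl
  | exploreAbove i hpos hi =>
    rw [inAbove_observe] at hi
    rw [sum_single_mul, hω.of_notMem hi.1]
    exact hi.2.le
  | trial k j v hpos habove hk hj =>
    obtain ⟨hk1, hk2, -⟩ := trial_spec hgap hpos habove hk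
    rw [inBelow_observe] at hj
    have hkj : k ≠ j := by rintro rfl; exact mem_unexplored.1 hj.1 hk1
    rw [sum_mix_mul_eq_zero hkj (l := 1)]
    · rw [hω.of_mem hk1, one_mul, hk2]
    · rw [hω.of_notMem hj.1, one_mul]
  | exploit k v hpos hall hk =>
    have hk1 := mem_observe.1 hk.1
    rw [sum_single_mul, hω.of_mem hk1.1]
    obtain ⟨i, w, hw, hw0⟩ := hpos
    exact (hw0.le.trans (hk.2 i w hw)).trans hk1.2.le

theorem totalReward_nonneg_of_isSegb (halg : IsSegb (mean P X) alg) {δ : ℝ}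
    (hω : IsTypical P X ω) (hgap : GapAtLeast (mean P X) (fun i => X i ω) δ) (n : ℕ)
    (acts : List (Action K)) : 0 ≤ totalReward P X alg n acts ω := by
  induction n generalizing acts with
  | zero => exact le_rfl
  | succ n ih =>
    exact add_nonneg (roundReward_nonneg_of_isSegb halg hω hgap acts)
      (Finset.sum_nonneg fun a _ => mul_nonneg (alg.nonneg _ a) (ih _))

theorem abs_le_maxNegMean {j : Fin K} (hj : m j < 0) : |m j| ≤ maxNegMean m := by
  have hmem : j ∈ Finset.univ.filter fun i => m i < 0 := by simpa using hj
  have hne : (Finset.univ.filter fun i => m i < 0).Nonempty := ⟨j, hmem⟩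
  rw [maxNegMean, dif_pos hne]
  exact Finset.le_sup' (fun i => |m i|) hmem

theorem maxNegMean_nonneg (m : Fin K → ℝ) : 0 ≤ maxNegMean m := by
  rw [maxNegMean]
  split_ifs with hne
  · obtain ⟨j, hj⟩ := hne
    exact (abs_nonneg (m j)).trans (Finset.le_sup' (fun i => |m i|) hj)
  · exact le_rfl

/-- Each unexplored arm is charged κ = 1 + γ/δ rounds of the maximum. A round that explores with
probability p earns back κp on average, which covers the round itself as soon as κp ≥ 1. -/
theorem le_totalReward_of_found (halg : IsSegb (mean P X) alg) {δ : ℝ} (hδ : 0 < δ)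
    (hω : IsTypical P X ω) (hgap : GapAtLeast (mean P X) (fun i => X i ω) δ) (n : ℕ)
    (acts : List (Action K)) (hf : Found (fun i => X i ω) acts) :
    (n - (1 + maxNegMean (mean P X) / δ) * (unexplored acts).card)
      * maxPos (fun i => X i ω) Finset.univ ≤ totalReward P X alg n acts ω := by
  have hγ := div_nonneg (maxNegMean_nonneg (mean P X)) hδ.le
  set κ := 1 + maxNegMean (mean P X) / δ with hκ
  set M := maxPos (fun i => X i ω) Finset.univ with hM
  have hM0 : 0 ≤ M := maxPos_nonneg _ _
  induction n generalizing acts with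
  | zero =>
    refine mul_nonpos_of_nonpos_of_nonneg ?_ hM0
    have : 0 ≤ κ * ((unexplored acts).card : ℝ) := by positivity
    push_cast
    linarith
  | succ n ih =>
    have hih := fun a => ih (a :: acts) (hf.cons a)
    have hround := roundReward_nonneg_of_isSegb halg hω hgap acts
    rw [totalReward]
    have key := halg acts fun i => X i ω
    have hfo := hasPositive_observe.2 hf
    unfold roundReward played at hround ⊢
    generalize alg.portfolio (observe (fun i => X i ω) acts) = p at key hround ⊢
    push_cast
    cases key with
    | ogpMix i j hpos hi hj hmax => exact absurd hfo hpos
    | ogpSingle i hpos hi hbelow => exact absurd hfo hpos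
    | safe hpos habove => exact absurd hfo hpos
    | exploreAbove i hpos hi =>
      rw [inAbove_observe] at hi
      have h1 := hih (some i)
      rw [card_unexplored_cons (mem_unexplored.1 hi.1)] at h1
      rw [sum_single_mul (f := fun a => totalReward P X alg n (a :: acts) ω)]
      have h2 := mul_nonneg hγ hM0
      rw [hκ] at h1 ⊢
      linarith
    | trial k j v hpos habove hk hj =>
      obtain ⟨hk1, -, hv⟩ := trial_spec hgap hpos habove hk
      rw [inBelow_observe] at hj
      have hkj : k ≠ j := by rintro rfl; exact mem_unexplored.1 hj.1 hk1
      rw [sum_mix_mul hkj (f := fun a => totalReward P X alg n (a :: acts) ω)]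
      have h1 := hih (some k)
      have h2 := hih (some j)
      rw [unexplored_cons_of_mem hk1] at h1
      rw [card_unexplored_cons (mem_unexplored.1 hj.1)] at h2
      have hv0 : 0 < v := hδ.trans_le hv
      have hd : 0 < v - mean P X j := by linarith [hj.2]
      have hp1 : 0 ≤ -mean P X j / (v - mean P X j) := div_nonneg (by linarith [hj.2]) hd.le
      have hp2 : 0 ≤ v / (v - mean P X j) := div_nonneg hv0.le hd.le
      have hsum : -mean P X j / (v - mean P X j) + v / (v - mean P X j) = 1 := by
        field_simp; ring
      -- From v ≥ δ: κv = v + (γ/δ)v ≥ v + γ ≥ v − μ(a_j).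
      have hκp : 1 ≤ κ * (v / (v - mean P X j)) := by
        have h3 : -mean P X j ≤ maxNegMean (mean P X) := by
          rw [← abs_of_neg hj.2]; exact abs_le_maxNegMean hj.2
        have h4 : maxNegMean (mean P X) ≤ maxNegMean (mean P X) / δ * v := by
          rw [div_mul_eq_mul_div, le_div_iff₀ hδ]
          exact mul_le_mul_of_nonneg_left hv (maxNegMean_nonneg _)
        rw [← mul_div_assoc, le_div_iff₀ hd, hκ]
        linarith
      have h1' := mul_le_mul_of_nonneg_left h1 hp1
      have h2' := mul_le_mul_of_nonneg_left h2 hp2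
      have h5 := mul_le_mul_of_nonneg_right hκp hM0
      generalize -mean P X j / (v - mean P X j) = p1 at *
      generalize v / (v - mean P X j) = p2 at *
      obtain rfl : p1 = 1 - p2 := by linarith
      linarith
    | exploit k v hpos hall hk =>
      have hk1 := mem_observe.1 hk.1
      rw [sum_single_mul, sum_single_mul (f := fun a => totalReward P X alg n (a :: acts) ω),
        hω.of_mem hk1.1]
      have h0 : unexplored acts = ∅ := by
        ext i
        simpa [mem_unexplored] using explored_observe.1 (hall i)
      have h1 := hih (some k)
      rw [unexplored_cons_of_mem hk1.1, h0] at h1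
      have h2 : M ≤ X k ω := by
        obtain ⟨i, hi, hi0⟩ := hf
        refine maxPos_le ?_ fun i _ => ?_
        · exact hi0.le.trans ((hk.2 i _ (mem_observe.2 ⟨hi, rfl⟩)).trans hk1.2.le)
        · exact (hk.2 i _ (mem_observe.2 ⟨explored_observe.1 (hall i), rfl⟩)).trans hk1.2.le
      simp only [h0, Finset.card_empty, Nat.cast_zero, mul_zero, sub_zero] at h1 ⊢
      linarith

/-- Complementary slackness: SEGB uses only arms for which the price inequality is tight, and its
mixture has mean zero. When no negative-mean arm is left its reward is positive, but there the price
is zero. -/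
theorem lossChange_of_isSegb (halg : IsSegb (mean P X) alg) (hC : IsLoss P X C)
    (hne : ∀ i, mean P X i ≠ 0) (hf : ¬ Found (fun i => X i ω) acts) {k : Fin K} (hk : k ∈ unexplored acts)
    (hk0 : 0 < mean P X k) :
    (∀ a, (∀ i ∈ unexplored acts, a ≠ some i) → played alg X acts ω a = 0) ∧
      ∑ a, played alg X acts ω a * lossChange P X C (unexplored acts) a = 0 := by
  obtain ⟨l, -, -, habove', hbelow', hzero⟩ := hC.exists_price (unexplored acts)
  have hfo := mt hasPositive_observe.1 hf
  have key := halg acts fun i => X i ω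
  unfold played
  generalize alg.portfolio (observe (fun i => X i ω) acts) = p at key ⊢
  have hchange : ∀ i ∈ unexplored acts, lossChange P X C (unexplored acts) (some i)
      = probNonpos P X i * C ((unexplored acts).erase i) - C (unexplored acts) := fun i hi => by
    simp only [lossChange, hi, if_true]
  cases key with
  | ogpMix i j hpos hi hj hmax =>
    rw [inAbove_observe] at hi
    rw [inBelow_observe] at hj
    simp only [inBelow_observe] at hmax
    have hij : i ≠ j := by rintro rfl; exact lt_asymm hi.2 hj.2
    refine ⟨fun a ha => ?_, sum_mix_mul_eq_zero hij (l := l) ?_ ?_⟩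
    · simp [mix, ha i hi.1, ha j hj.1]
    · rw [hchange i hi.1, habove' i hi.1 hi.2]
    · rw [hchange j hj.1, hbelow' j hj.1 hj.2 fun b hb hb0 => hmax b ⟨hb, hb0⟩]
  | ogpSingle i hpos hi hbelow =>
    rw [inAbove_observe] at hi
    simp only [inBelow_observe, not_and, not_lt] at hbelow
    refine ⟨fun a ha => by simp [single, ha i hi.1], ?_⟩
    rw [sum_single_mul, hchange i hi.1, habove' i hi.1 hi.2]
    rw [hzero fun a ha => lt_of_le_of_ne (hbelow a ha) (hne a).symm, zero_mul]
  | safe hpos habove => exact absurd (inAbove_observe.2 ⟨hk, hk0⟩) (habove k)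
  | exploreAbove i hpos hi => exact absurd hpos hfo
  | trial k j v hpos habove hk hj => exact absurd hpos hfo
  | exploit k v hpos hall hk => exact absurd hpos hfo

end LowerBound

/-! ### The utility of SEGB and the realized gap -/

section Main

variable {K : ℕ} {Ω : Type*} [MeasurableSpace Ω] {P : Measure Ω} [IsProbabilityMeasure P]
  {X : Fin K → Ω → ℝ} {C : Finset (Fin K) → ℝ}

/-- While nothing positive is found and a positive-mean arm remains, the potential is preserved on
average and every round explores a new arm. Once no such arm remains, the potential is zero. -/
theorem le_integral_unfound_mul_totalReward (hX : ∀ i, Measurable (X i)) (hint : ∀ i, Integrable (X i) P)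
    (hind : iIndepFun X P) (hne : ∀ i, mean P X i ≠ 0) (hC : IsLoss P X C) {alg : Algorithm K}
    (halg : IsSegb (mean P X) alg) {δ : ℝ}
    (hgap : ∀ᵐ ω ∂P, GapAtLeast (mean P X) (fun i => X i ω) δ) {κ : ℝ} (hκ : 1 ≤ κ) (n : ℕ)
    (ih : ∀ (acts : List (Action K)) (w : Ω → ℝ), IsWeight X acts w →
      (n - κ * (unexplored acts).card) * ∫ ω, w ω * potential P X C acts ω ∂P
        ≤ ∫ ω, w ω * totalReward P X alg n acts ω ∂P)
    {acts : List (Action K)} {w : Ω → ℝ} (hw : IsWeight X acts w) :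
    ((n + 1 : ℕ) - κ * (unexplored acts).card) * ∫ ω, unfound X acts w ω * potential P X C acts ω ∂P
      ≤ ∫ ω, unfound X acts w ω * totalReward P X alg (n + 1) acts ω ∂P := by
  set u := unfound X acts w with hu
  have huw : IsWeight X acts u := hw.unfound
  have hu0 : ∀ ω, Found (fun i => X i ω) acts → u ω = 0 := fun ω h => by simp [hu, unfound, h]
  by_cases hk : ∃ k ∈ unexplored acts, 0 < mean P X k
  · obtain ⟨k, hk, hk0⟩ := hk
    have hround : 0 ≤ ∫ ω, u ω * roundReward P X alg acts ω ∂P := by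
      refine integral_nonneg_of_ae ?_
      filter_upwards [ae_isTypical hX hint hind, hgap] with ω hω hg
      exact mul_nonneg (huw.nonneg ω) (roundReward_nonneg_of_isSegb halg hω hg acts)
    have hzero : ∫ ω, unfound X acts u ω *
        ∑ a, played alg X acts ω a * lossChange P X C (unexplored acts) a ∂P = 0 := by
      refine integral_eq_zero_of_ae (ae_of_all _ fun ω => ?_)
      by_cases hf : Found (fun i => X i ω) acts
      · simp [unfound, hf]
      · simp [(lossChange_of_isSegb halg hC hne hf hk hk0).2]
    have hsum := sum_integral_mul_potential_cons (C := C) hX hint hind huw alg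
    rw [hzero, sub_zero] at hsum
    rw [integral_mul_totalReward_succ hX huw alg n, ← hsum, Finset.mul_sum]
    refine (Finset.sum_le_sum fun a _ => ?_).trans (le_add_of_nonneg_left hround)
    refine le_trans ?_ (ih (a :: acts) _ ((huw.mul (isWeight_played alg X acts a)).cons a))
    by_cases ha : ∃ i ∈ unexplored acts, a = some i
    · obtain ⟨i, hi, rfl⟩ := ha
      rw [card_unexplored_cons (mem_unexplored.1 hi)]
      -- One round is lost and one arm is removed from the count, which costs nothing because κ ≥ 1.
      refine mul_le_mul_of_nonneg_right ?_ (integral_nonneg fun ω => mul_nonneg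
        (mul_nonneg (huw.nonneg ω) (alg.nonneg _ _)) (potential_nonneg hC _ ω))
      push_cast
      linarith
    · have h0 : ∀ ω, u ω * played alg X acts ω a * potential P X C (a :: acts) ω = 0 := by
        intro ω
        by_cases hf : Found (fun i => X i ω) acts
        · simp [hu0 ω hf]
        · have := (lossChange_of_isSegb halg hC hne hf hk hk0).1 a fun i hi h => ha ⟨i, hi, h⟩
          simp [this]
      simp [h0]
  · have h0 : ∀ ω, u ω * potential P X C acts ω = 0 := by
      intro ω
      by_cases hf : Found (fun i => X i ω) acts
      · simp [hu0 ω hf]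
      · have : C (unexplored acts) = meanMaxPos P X (unexplored acts) :=
          hC.terminal _ fun i hi => lt_of_le_of_ne (not_lt.1 fun h => hk ⟨i, hi, h⟩) (hne i)
        simp [potential, hf, this]
    simp only [h0, integral_zero, mul_zero]
    refine integral_nonneg_of_ae ?_
    filter_upwards [ae_isTypical hX hint hind, hgap] with ω hω hg
    exact mul_nonneg (huw.nonneg ω) (totalReward_nonneg_of_isSegb halg hω hg _ acts)

/-- States with a positive reward found are handled pointwise by `le_totalReward_of_found`, the
others on average by the preceding lemma. -/
theorem le_integral_mul_totalReward (hX : ∀ i, Measurable (X i)) (hint : ∀ i, Integrable (X i) P)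
    (hind : iIndepFun X P) (hne : ∀ i, mean P X i ≠ 0) (hC : IsLoss P X C) {alg : Algorithm K}
    (halg : IsSegb (mean P X) alg) {δ : ℝ} (hδ : 0 < δ)
    (hgap : ∀ᵐ ω ∂P, GapAtLeast (mean P X) (fun i => X i ω) δ) (n : ℕ)
    (acts : List (Action K)) (w : Ω → ℝ) (hw : IsWeight X acts w) :
    (n - (1 + maxNegMean (mean P X) / δ) * (unexplored acts).card)
        * ∫ ω, w ω * potential P X C acts ω ∂P
      ≤ ∫ ω, w ω * totalReward P X alg n acts ω ∂P := by
  have hκ : 1 ≤ 1 + maxNegMean (mean P X) / δ :=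
    le_add_of_nonneg_right (div_nonneg (maxNegMean_nonneg _) hδ.le)
  induction n generalizing acts w with
  | zero =>
    simp only [totalReward, mul_zero, integral_zero, Nat.cast_zero, zero_sub]
    refine mul_nonpos_of_nonpos_of_nonneg (neg_nonpos.2 (by positivity)) (integral_nonneg fun ω =>
      mul_nonneg (hw.nonneg ω) (potential_nonneg hC _ ω))
  | succ n ih =>
    have h1 := le_integral_unfound_mul_totalReward hX hint hind hne hC halg hgap hκ n ih hw
    set c : ℝ := ((n + 1 : ℕ) : ℝ) - (1 + maxNegMean (mean P X) / δ) * (unexplored acts).card with hc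
    have i1 := hw.integrable_mul hX (integrable_potential hX hint C acts)
    have i2 := hw.unfound.integrable_mul hX (integrable_potential hX hint C acts)
    have i3 := hw.integrable_mul hX (integrable_totalReward (P := P) hX alg (n + 1) acts)
    have i4 := hw.unfound.integrable_mul hX (integrable_totalReward (P := P) hX alg (n + 1) acts)
    have h2 : ∫ ω, c * (w ω * potential P X C acts ω - unfound X acts w ω * potential P X C acts ω) ∂P
        ≤ ∫ ω, (w ω * totalReward P X alg (n + 1) acts ω
          - unfound X acts w ω * totalReward P X alg (n + 1) acts ω) ∂P := by
      refine integral_mono_ae ((i1.sub i2).const_mul c) (i3.sub i4) ?_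
      filter_upwards [ae_isTypical hX hint hind, hgap] with ω hω hg
      by_cases hf : Found (fun i => X i ω) acts
      · have h3 := mul_le_mul_of_nonneg_left
          (le_totalReward_of_found halg hδ hω hg (n + 1) acts hf) (hw.nonneg ω)
        rw [← hc] at h3
        simp only [unfound, potential, hf, if_true, zero_mul, sub_zero]
        linarith
      · simp [unfound, hf]
    rw [integral_const_mul, integral_sub i1 i2, integral_sub i3 i4] at h2
    linarith

theorem le_utility_of_isSegb (hX : ∀ i, Measurable (X i)) (hint : ∀ i, Integrable (X i) P)
    (hind : iIndepFun X P) (hne : ∀ i, mean P X i ≠ 0) (hC : IsLoss P X C) {alg : Algorithm K}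
    (halg : IsSegb (mean P X) alg) {δ : ℝ} (hδ : 0 < δ)
    (hgap : ∀ᵐ ω ∂P, GapAtLeast (mean P X) (fun i => X i ω) δ) (T : ℕ) :
    (T - K * (1 + maxNegMean (mean P X) / δ)) * (meanMaxPos P X Finset.univ - C Finset.univ)
      ≤ utility P X alg T := by
  have h := le_integral_mul_totalReward hX hint hind hne hC halg hδ hgap T [] 1
    ⟨measurable_const (a := (1 : ℝ)), fun _ => zero_le_one, fun _ => le_rfl⟩
  have hf : ∀ ω, ¬ Found (fun i => X i ω) ([] : List (Action K)) := fun ω => by simp [Found]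
  simpa [potential, hf, unexplored_nil, utility, mul_comm] using h

theorem measure_preimage_Iic_ne_zero {P : Measure Ω} {i : Fin K} (hi : mean P X i < 0) :
    P (X i ⁻¹' Set.Iic 0) ≠ 0 := by
  intro h
  refine hi.not_ge (integral_nonneg_of_ae ?_)
  filter_upwards [measure_eq_zero_iff_ae_notMem.1 h] with ω hω
  exact (not_le.1 hω).le

/-- The gap assumption could hold through δ₁ alone, with δ₂ < δ. But independently of the
positive-mean arms, all negative-mean arms are nonpositive with positive probability, and then δ₁ is
undefined; hence δ₂ ≥ δ almost surely whenever it is defined. -/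
theorem ae_exists_le_of_pos {P : Measure Ω} (hX : ∀ i, Measurable (X i)) (hind : iIndepFun X P) {δ : ℝ}
    (hgap : ∀ᵐ ω ∂P, realizedGap (mean P X) (fun i => X i ω) ≠ ⊥ →
      (δ : WithBot ℝ) ≤ realizedGap (mean P X) (fun i => X i ω)) :
    ∀ᵐ ω ∂P, (∃ i, 0 < mean P X i ∧ 0 < X i ω) → ∃ i, 0 < mean P X i ∧ δ ≤ X i ω := by
  let E : Set Ω := ⋂ i ∈ (Finset.univ.filter fun i => mean P X i < 0), X i ⁻¹' Set.Iic 0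
  let F : Set Ω := (⋃ i, ⋃ (_ : 0 < mean P X i), X i ⁻¹' Set.Ioi 0) ∩
    ⋂ i, ⋂ (_ : 0 < mean P X i), X i ⁻¹' Set.Iio δ
  have hE : P E ≠ 0 := by
    rw [hind.measure_inter_preimage_eq_mul _ fun i _ => measurableSet_Iic]
    exact Finset.prod_ne_zero_iff.2 fun i hi => measure_preimage_Iic_ne_zero (by simpa using hi)
  have hEm : MeasurableSet[armsInfo X {i | mean P X i < 0}] E :=
    MeasurableSet.iInter fun i => MeasurableSet.iInter fun hi =>
      measurable_armsInfo X (S := {i | mean P X i < 0}) (by simpa using hi) measurableSet_Iic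
  have hFm : MeasurableSet[armsInfo X {i | 0 < mean P X i}] F :=
    MeasurableSet.inter
      (MeasurableSet.iUnion fun i => MeasurableSet.iUnion fun hi =>
        measurable_armsInfo X (S := {i | 0 < mean P X i}) hi measurableSet_Ioi)
      (MeasurableSet.iInter fun i => MeasurableSet.iInter fun hi =>
        measurable_armsInfo X (S := {i | 0 < mean P X i}) hi measurableSet_Iio)
  have hd : Disjoint {i | mean P X i < 0} {i | 0 < mean P X i} := by
    rw [Set.disjoint_left]
    intro i hi hi'
    exact lt_asymm (show mean P X i < 0 from hi) hi'
  have hprod : P (E ∩ F) = P E * P F :=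
    (Indep_iff _ _ _).1 (indep_iSup_of_disjoint (fun i => (hX i).comap_le) hind.iIndep hd) E F hEm hFm
  have hEF : P (E ∩ F) = 0 := by
    rw [measure_eq_zero_iff_ae_notMem]
    filter_upwards [hgap] with ω hω hmem
    obtain ⟨hωE, hωF1, hωF2⟩ := hmem
    simp only [E, Finset.mem_filter, Finset.mem_univ, true_and, Set.mem_iInter, Set.mem_preimage,
      Set.mem_Iic] at hωE
    simp only [Set.mem_iUnion, Set.mem_iInter, Set.mem_preimage, Set.mem_Ioi, Set.mem_Iio] at hωF1 hωF2
    obtain ⟨i, hi, hi0⟩ := hωF1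
    have hbelow : gapBelow (mean P X) (fun i => X i ω) = ⊥ := by
      have : ¬ (posBelow (mean P X) fun i => X i ω).Nonempty := by
        rintro ⟨j, hj⟩
        simp only [posBelow, Finset.mem_filter, Finset.mem_univ, true_and] at hj
        exact (hωE j hj.1).not_gt hj.2
      simp [gapBelow, this]
    have hle : ((X i ω : ℝ) : WithBot ℝ) ≤ gapAbove (mean P X) fun i => X i ω :=
      Finset.le_sup (f := fun i => ((X i ω : ℝ) : WithBot ℝ)) (by simp [posAbove, hi, hi0])
    have hlt : gapAbove (mean P X) (fun i => X i ω) < (δ : WithBot ℝ) := by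
      refine (Finset.sup_lt_iff (WithBot.bot_lt_coe δ)).2 fun j hj => ?_
      simp only [posAbove, Finset.mem_filter, Finset.mem_univ, true_and] at hj
      exact WithBot.coe_lt_coe.2 (hωF2 j hj.1)
    rw [realizedGap, hbelow, max_eq_right bot_le] at hω
    exact (hω (ne_bot_of_le_ne_bot WithBot.coe_ne_bot hle)).not_gt hlt
  rw [hprod, mul_eq_zero, or_iff_right hE, measure_eq_zero_iff_ae_notMem] at hEF
  filter_upwards [hEF] with ω hω hpos
  by_contra! hcon
  refine hω ⟨?_, ?_⟩
  · simpa using hpos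
  · simpa using hcon

theorem ae_gapAtLeast {P : Measure Ω} (hX : ∀ i, Measurable (X i)) (hind : iIndepFun X P)
    (hne : ∀ i, mean P X i ≠ 0) {δ : ℝ}
    (hgap : ∀ᵐ ω ∂P, realizedGap (mean P X) (fun i => X i ω) ≠ ⊥ →
      (δ : WithBot ℝ) ≤ realizedGap (mean P X) (fun i => X i ω)) :
    ∀ᵐ ω ∂P, GapAtLeast (mean P X) (fun i => X i ω) δ := by
  filter_upwards [hgap, ae_exists_le_of_pos hX hind hgap] with ω h1 h2 v hv habove
  by_cases hpos : ∃ i, 0 < mean P X i ∧ 0 < X i ω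
  -- With a positive reward among the positive-mean arms, δ₂ ≥ δ is enough; otherwise only δ₁ is
  -- defined, and it lies below any positive reward.
  · obtain ⟨i, hi, hi0⟩ := h2 hpos
    exact hi0.trans (habove i hi)
  · push Not at hpos
    obtain ⟨i, hi0, hiv⟩ := hv
    have hi : mean P X i < 0 := by
      by_contra hcon
      exact (hpos i (lt_of_le_of_ne (not_lt.1 hcon) (hne i).symm)).not_gt hi0
    have hmem : i ∈ posBelow (mean P X) fun i => X i ω := by simp [posBelow, hi, hi0]
    have hemp : posAbove (mean P X) (fun i => X i ω) = ∅ := by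
      simp only [posAbove, Finset.filter_eq_empty_iff]
      rintro j - ⟨hj, hj0⟩
      exact (hpos j hj).not_gt hj0
    have hbelow : gapBelow (mean P X) (fun i => X i ω)
        = (((posBelow (mean P X) fun i => X i ω).inf' ⟨i, hmem⟩ (fun i => X i ω) : ℝ) : WithBot ℝ) := by
      rw [gapBelow, dif_pos ⟨i, hmem⟩]
    have habove' : gapAbove (mean P X) (fun i => X i ω) = ⊥ := by
      simp [gapAbove, hemp]
    rw [realizedGap, habove', max_eq_left bot_le, hbelow] at h1
    exact (WithBot.coe_le_coe.1 (h1 WithBot.coe_ne_bot)).trans ((Finset.inf'_le _ hmem).trans hiv)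

end Main

end BayesSafe

theorem mainTheorem5 {K : ℕ} {Ω : Type*} [MeasurableSpace Ω] (P : Measure Ω) [IsProbabilityMeasure P]
    (X : Fin K → Ω → ℝ)
    (hmeas : ∀ i, Measurable (X i))
    (hint : ∀ i, Integrable (X i) P)
    (hindep : iIndepFun X P)
    (hne : ∀ i, BayesSafe.mean P X i ≠ 0)
    (hord : BayesSafe.BelowOrdered P X)
    (δ : ℝ) (hδ : 0 < δ)
    (hgap : ∀ᵐ ω ∂P, BayesSafe.realizedGap (BayesSafe.mean P X) (fun i => X i ω) ≠ ⊥ →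
      (δ : WithBot ℝ) ≤ BayesSafe.realizedGap (BayesSafe.mean P X) (fun i => X i ω)) :
    ∃ T₀ : ℕ, ∀ alg : BayesSafe.Algorithm K, BayesSafe.IsSegb (BayesSafe.mean P X) alg →
      ∀ T : ℕ, T₀ < T →
        (1 - K * (1 + BayesSafe.maxNegMean (BayesSafe.mean P X) / δ) / T) * BayesSafe.opt P X T
          ≤ BayesSafe.utility P X alg T := by
  obtain ⟨C, hC⟩ := BayesSafe.exists_isLoss hmeas hint hindep hne hord
  have hg := BayesSafe.ae_gapAtLeast hmeas hindep hne hgap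
  set c : ℝ := K * (1 + BayesSafe.maxNegMean (BayesSafe.mean P X) / δ) with hc
  -- T > c makes the factor 1 − c/T nonnegative, so that the upper bound for OPT can be multiplied
  -- by it.
  refine ⟨⌈c⌉₊, fun alg halg T hT => ?_⟩
  have hcT : c < T := Nat.lt_of_ceil_lt hT
  have hT0 : (0 : ℝ) < T := Nat.cast_pos.2 (by omega)
  refine le_trans ?_ (BayesSafe.le_utility_of_isSegb hmeas hint hindep hne hC halg hδ hg T)
  have h1 : 0 ≤ 1 - c / T := by
    rw [sub_nonneg, div_le_one hT0]
    exact hcT.le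
  refine (mul_le_mul_of_nonneg_left (BayesSafe.opt_le hmeas hint hindep hC T) h1).trans_eq ?_
  rw [← hc]
  field_simp
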